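/- **Private range finder.** Let $A\in\mathbb R^{m\times n}$, let $r\ge 0$ and $p\ge 0$ be integers, put $k=r+p$ and assume $k\le\min\{m,n\}$. For a noise scale $\rho\ge 0$, the private range finder draws an $n\times k$ standard Gaussian matrix $\Omega$ and, independently, an $m\times k$ matrix $N$ with i.i.d. $N(0,\rho^2)$ entries, forms $\tilde Y=A\Omega+N$, and returns the $m\times k$ matrix $W$ obtained by Gram–Schmidt orthonormalization of the columns of $\tilde Y$ (a column that depends linearly on the preceding ones, if there is any, is replaced by $0$). Let $\sigma_1\ge\sigma_2\ge\dots$ be the singular values of $A$, with $\sigma_j=0$ for $j>\min\{m,n\}$. Two matrices in $\mathbb R^{m\times n}$ are neighboring if they differ in at most one row and the difference of these rows has Euclidean norm at most $1$; a randomized algorithm $M$ on $\mathbb R^{m\times n}$ is $(\varepsilon,\delta)$-differentially private if $\Pr[M(A)\in S]\le e^{\varepsilon}\Pr[M(A')\in S]+\delta$ for all neighboring $A,A'$ and all measurable $S$. 1. (Privacy) If $\varepsilon,\delta\in(0,1)$ and $\rho\ge 2\varepsilon^{-1}\sqrt{2k}\,\log(4k/\delta)$ (for $k=0$: $\rho\ge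 0$), then the algorithm $A\mapsto W$ is $(\varepsilon,\delta)$-differentially private. 2. (Expected error) If $p\ge 2$, then for every $\rho\ge 0$ and every $A$, $$\mathbb E\,\|A-WW^{T}A\|_F\le\Bigl(1+\frac{r}{p-1}\Bigr)^{1/2}\sqrt{\sum_{j=r+1}^{m}(\sigma_j+\rho)^2}.$$ 3. (Error with high probability) There is an absolute constant $C>0$ such that, if $m\le n$ and $p\ge r+1$, then for every $\rho\ge 0$ and every $A$, with probability at least $99/100$, $$\|A-WW^{T}A\|_F\le C\Bigl(\sqrt{\sum_{j=r+1}^{m}\sigma_j^2}+\rho\sqrt m\Bigr).$$ -/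

import Mathlib

open MeasureTheory ProbabilityTheory
open scoped Matrix Matrix.Norms.Frobenius

/-- The product (equivalently, Borel) sigma-algebra on real matrices. -/
instance RangeFinder.instMeasurableSpaceMatrix {m k : ℕ} :
    MeasurableSpace (Matrix (Fin m) (Fin k) ℝ) :=
  inferInstanceAs (MeasurableSpace (Fin m → Fin k → ℝ))

namespace RangeFinder

/-- Two databases are neighboring if their difference is zero outside one row, and that row has
Euclidean norm at most `1`. -/
def Neighboring {m n : ℕ} (A A' : Matrix (Fin m) (Fin n) ℝ) : Prop :=
  ∃ i : Fin m, ‖(WithLp.toLp 2 ((A - A') i) : EuclideanSpace ℝ (Fin n))‖ ≤ 1 ∧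
    ∀ j : Fin m, j ≠ i → (A - A') j = 0

/-- A randomized algorithm, given as a function `M` of the database and of a random seed drawn
from the probability measure `P`, is `(ε, δ)`-differentially private. -/
def IsDifferentiallyPrivate {m n : ℕ} {Θ R : Type*} [MeasurableSpace Θ] [MeasurableSpace R]
    (P : Measure Θ) (M : Matrix (Fin m) (Fin n) ℝ → Θ → R) (ε δ : ℝ) : Prop :=
  ∀ A A' : Matrix (Fin m) (Fin n) ℝ, Neighboring A A' →
    ∀ S : Set R, MeasurableSet S →
      P {θ | M A θ ∈ S} ≤
        ENNReal.ofReal (Real.exp ε) * P {θ | M A' θ ∈ S} + ENNReal.ofReal δ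

/-- The law of an `m × k` random matrix with independent entries of law `N(0, ρ²)`. -/
noncomputable def gaussianMatrix (m k : ℕ) (ρ : ℝ) : Measure (Matrix (Fin m) (Fin k) ℝ) :=
  (Measure.pi fun _ : Fin m => Measure.pi fun _ : Fin k => gaussianReal 0 (Real.toNNReal (ρ ^ 2)) :
    Measure (Fin m → Fin k → ℝ))

/-- Gram–Schmidt orthonormalization of the columns of `Y` (from left to right). The columns of the
result are orthonormal if those of `Y` are linearly independent; in general its nonzero columns
form an orthonormal basis of the column space of `Y`. -/
noncomputable def orthonormalizeColumns {m k : ℕ} (Y : Matrix (Fin m) (Fin k) ℝ) :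
    Matrix (Fin m) (Fin k) ℝ :=
  Matrix.of fun i j =>
    InnerProductSpace.gramSchmidtNormed ℝ
      (fun l : Fin k => (WithLp.toLp 2 (fun a => Y a l) : EuclideanSpace ℝ (Fin m))) j i

/-- The law of the random seed `(Ω, N)`: a standard Gaussian `n × k` matrix `Ω` and, independently,
an `m × k` matrix `N` with independent entries of law `N(0, ρ²)`. -/
noncomputable def seed (m n k : ℕ) (ρ : ℝ) :
    Measure (Matrix (Fin n) (Fin k) ℝ × Matrix (Fin m) (Fin k) ℝ) :=
  (gaussianMatrix n k 1).prod (gaussianMatrix m k ρ)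

/-- The output `W` of the private range finder on input `A` with random seed `(Ω, N)`. -/
noncomputable def output {m n k : ℕ} (A : Matrix (Fin m) (Fin n) ℝ)
    (θ : Matrix (Fin n) (Fin k) ℝ × Matrix (Fin m) (Fin k) ℝ) : Matrix (Fin m) (Fin k) ℝ :=
  orthonormalizeColumns (A * θ.1 + θ.2)

/-- The scale `2 ε⁻¹ √(2k) log(4k/δ)` of the Gaussian noise. -/
noncomputable def noiseScale (k : ℕ) (ε δ : ℝ) : ℝ :=
  2 * ε⁻¹ * √(2 * k) * Real.log (4 * k / δ)

/-- The Frobenius error `‖A - W Wᵀ A‖_F` of an `m × k` matrix `W`. -/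
noncomputable def error {m n k : ℕ} (A : Matrix (Fin m) (Fin n) ℝ)
    (W : Matrix (Fin m) (Fin k) ℝ) : ℝ :=
  ‖A - W * Wᵀ * A‖

/-- The singular values of `A` in decreasing order, counted from `0`, and continued by zeros after
the first `min m n`. -/
noncomputable def singularValue {m n : ℕ} (A : Matrix (Fin m) (Fin n) ℝ) (j : ℕ) : ℝ :=
  (Matrix.toEuclideanLin A).singularValues j

end RangeFinder

/-!
# Privacy and accuracy of the private range finder

**Accuracy.** The columns of the sketch `A Ω + N` are independent centred Gaussian vectors with
covariance `A Aᵀ + ρ² 1`. Let `U` consist of left singular vectors of `A`, let `D` be the diagonal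
matrix with entries `√(σⱼ² + ρ²)`, and let `H` be a standard Gaussian `m × k` matrix. Then the sketch
has the law of `U D H` (`map_sketch_seed_eq`, `exists_sqrt_covariance`), which removes the two sources
of randomness and all rotations at once. For such a sketch the argument of Halko, Martinsson and
Tropp becomes elementary. With `W` spanning the range of `U D H`, the error `‖A - W Wᵀ A‖` is at most
`‖U D - W Wᵀ U D‖`, hence at most `‖U D - (U D H) X‖` for every `X` (`error_le_of_covariance`). If the
first `r` columns `tᵢ` of `X` are dual to the first `r` rows `hᵢ` of `H` and its other columns vanish,
the square of this norm is `∑ j ≥ r, (σⱼ² + ρ²) (1 + ∑ i < r, ⟪hⱼ, tᵢ⟫²)` (`error_sq_le`).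

Here `hⱼ` is independent of `tᵢ`, so `⟪hⱼ, tᵢ⟫²` has the expectation of `‖tᵢ‖²`. The dual vector `tᵢ` is
the component of `hᵢ` orthogonal to the other leading rows, divided by its squared length, so `‖tᵢ‖⁻²`
is a chi-square variable with at least `p + 1` degrees of freedom given these other rows, and `‖tᵢ‖²`
has expectation at most `1 / (p - 1)` (`lintegral_inv_sum_sq`, `lintegral_inv_residual_le`). The
bound for the expected error follows from the one for the mean square, and Markov's inequality gives
the bound with high probability; for `r = 0` the latter is just `‖A - W Wᵀ A‖ ≤ ‖A‖`.

**Privacy.** For neighboring `A`, `A'` and given `Ω`, the matrices `A Ω` and `A' Ω` differ in one row, by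
`vᵀ Ω` with `‖v‖ ≤ 1`. With `L = log (4 k / δ)`, each of its `k` Gaussian entries is at most `√(2 L)` in
absolute value except with probability `2 exp (-L) = δ / (2 k)` (`measure_sensitivity_le`). If all are,
the addition of `N` is a Gaussian mechanism with sensitivity at most `√(2 k L)`, whose privacy loss is
controlled by the explicit density of a shifted Gaussian vector (`gaussian_mechanism`).
-/

namespace RangeFinder

/-! ### Characteristic functions and laws of Gaussian matrices -/

theorem integral_cexp_pi_gaussianReal {ι : Type*} [Fintype ι] (v : NNReal) (c : ι → ℝ) :
    ∫ x, Complex.exp (((∑ i, c i * x i : ℝ) : ℂ) * Complex.I)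
      ∂(Measure.pi fun _ : ι => gaussianReal 0 v) =
      Complex.exp (((-(v * (∑ i, c i ^ 2)) / 2 : ℝ) : ℂ)) := by
  have h1 : ∀ x : ι → ℝ, Complex.exp (((∑ i, c i * x i : ℝ) : ℂ) * Complex.I) =
      ∏ i, Complex.exp ((c i : ℂ) * (x i : ℂ) * Complex.I) := by
    intro x
    rw [← Complex.exp_sum]
    congr 1
    push_cast
    rw [Finset.sum_mul]
  simp_rw [h1]
  rw [integral_fintype_prod_eq_prod (𝕜 := ℂ)
    (fun i (x : ℝ) => Complex.exp ((c i : ℂ) * (x : ℂ) * Complex.I))]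
  simp_rw [← charFun_apply_real, charFun_gaussianReal]
  rw [← Complex.exp_sum]
  congr 1
  push_cast
  rw [Finset.mul_sum, ← Finset.sum_neg_distrib, Finset.sum_div]
  refine Finset.sum_congr rfl fun i _ => ?_
  ring

instance {m k : ℕ} (ρ : ℝ) : IsProbabilityMeasure (gaussianMatrix m k ρ) :=
  inferInstanceAs (IsProbabilityMeasure (Measure.pi fun _ : Fin m => Measure.pi fun _ : Fin k =>
    gaussianReal 0 (Real.toNNReal (ρ ^ 2))))

instance {m n k : ℕ} (ρ : ℝ) : IsProbabilityMeasure (seed m n k ρ) :=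
  inferInstanceAs (IsProbabilityMeasure ((gaussianMatrix n k 1).prod (gaussianMatrix m k ρ)))

theorem integral_cexp_gaussianMatrix {m k : ℕ} (ρ : ℝ) (c : Matrix (Fin m) (Fin k) ℝ) :
    ∫ Y : Matrix (Fin m) (Fin k) ℝ,
        Complex.exp (((∑ i, ∑ j, c i j * Y i j : ℝ) : ℂ) * Complex.I) ∂(gaussianMatrix m k ρ) =
      Complex.exp (((-(ρ ^ 2 * (∑ i, ∑ j, c i j ^ 2)) / 2 : ℝ) : ℂ)) := by
  have h1 : ∀ Y : Fin m → Fin k → ℝ,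
      Complex.exp (((∑ i, ∑ j, c i j * Y i j : ℝ) : ℂ) * Complex.I) =
      ∏ i, Complex.exp (((∑ j, c i j * Y i j : ℝ) : ℂ) * Complex.I) := by
    intro Y
    rw [← Complex.exp_sum]
    congr 1
    push_cast
    rw [Finset.sum_mul]
  change ∫ Y : Fin m → Fin k → ℝ,
    Complex.exp (((∑ i, ∑ j, c i j * Y i j : ℝ) : ℂ) * Complex.I)
      ∂(Measure.pi fun _ : Fin m => Measure.pi fun _ : Fin k =>
        gaussianReal 0 (Real.toNNReal (ρ ^ 2))) = _
  simp_rw [h1]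
  rw [integral_fintype_prod_eq_prod (𝕜 := ℂ)
    (fun i (y : Fin k → ℝ) => Complex.exp (((∑ j, c i j * y j : ℝ) : ℂ) * Complex.I))]
  simp_rw [integral_cexp_pi_gaussianReal]
  rw [← Complex.exp_sum]
  congr 1
  rw [Real.coe_toNNReal _ (sq_nonneg ρ)]
  push_cast
  rw [Finset.mul_sum, ← Finset.sum_neg_distrib, Finset.sum_div]

theorem strongDual_pi_pi_apply {m k : ℕ} (L : StrongDual ℝ (Fin m → Fin k → ℝ))
    (Y : Fin m → Fin k → ℝ) :
    L Y = ∑ i, ∑ j, L (Pi.single i (Pi.single j 1)) * Y i j := by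
  have h : Y = ∑ i, ∑ j, Y i j • Pi.single i (Pi.single j (1 : ℝ)) := by
    ext a b
    simp [Finset.sum_apply, Pi.single_apply, ite_apply]
  conv_lhs => rw [h]
  simp [map_sum, mul_comm]

/-- The adjoint of left multiplication by `A` in the Frobenius inner product is left multiplication by
`Aᵀ`. -/
theorem sum_mul_matrix_mul {m n k : ℕ} (c : Matrix (Fin m) (Fin k) ℝ)
    (A : Matrix (Fin m) (Fin n) ℝ) (Z : Matrix (Fin n) (Fin k) ℝ) :
    ∑ i, ∑ j, c i j * (A * Z) i j = ∑ l, ∑ j, (Aᵀ * c) l j * Z l j := by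
  have h : ∀ (a b : ℕ) (x y : Matrix (Fin a) (Fin b) ℝ),
      ∑ i, ∑ j, x i j * y i j = (xᵀ * y).trace := by
    intro a b x y
    rw [Finset.sum_comm]
    simp [Matrix.trace, Matrix.mul_apply]
  rw [h, h, Matrix.transpose_mul, Matrix.transpose_transpose, Matrix.mul_assoc]

theorem sum_sq_eq_trace {m k : ℕ} (c : Matrix (Fin m) (Fin k) ℝ) :
    ∑ i, ∑ j, c i j ^ 2 = (cᵀ * c).trace := by
  rw [Finset.sum_comm]
  simp [Matrix.trace, Matrix.mul_apply, sq]

theorem measurable_apply_apply {m k : ℕ} (i : Fin m) (j : Fin k) :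
    Measurable fun Y : Matrix (Fin m) (Fin k) ℝ => Y i j :=
  (measurable_pi_apply j).comp (measurable_pi_apply (X := fun _ : Fin m => Fin k → ℝ) i)

theorem measurable_matrix_iff {α : Type*} [MeasurableSpace α] {m k : ℕ}
    {f : α → Matrix (Fin m) (Fin k) ℝ} :
    Measurable f ↔ ∀ i j, Measurable fun x => f x i j :=
  ⟨fun h i j => (measurable_apply_apply i j).comp h, fun h =>
    measurable_pi_iff.2 fun i => measurable_pi_iff.2 fun j => h i j⟩

theorem measurable_matrix_mul {α : Type*} [MeasurableSpace α] {m n k : ℕ}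
    {f : α → Matrix (Fin m) (Fin n) ℝ} {g : α → Matrix (Fin n) (Fin k) ℝ}
    (hf : Measurable f) (hg : Measurable g) : Measurable fun x => f x * g x := by
  rw [measurable_matrix_iff] at hf hg ⊢
  intro i j
  simp only [Matrix.mul_apply]
  exact Finset.measurable_sum _ fun l _ => (hf i l).mul (hg l j)

theorem measurable_sketch {m n k : ℕ} (A : Matrix (Fin m) (Fin n) ℝ) :
    Measurable fun θ : Matrix (Fin n) (Fin k) ℝ × Matrix (Fin m) (Fin k) ℝ => A * θ.1 + θ.2 := by
  have h1 : Measurable fun θ : Matrix (Fin n) (Fin k) ℝ × Matrix (Fin m) (Fin k) ℝ => A * θ.1 :=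
    measurable_matrix_mul measurable_const measurable_fst
  rw [measurable_matrix_iff] at h1 ⊢
  exact fun i j => (h1 i j).add ((measurable_apply_apply i j).comp measurable_snd)

/-- The law of `A Ω + N` depends only on the covariance `A Aᵀ + ρ² 1` of its columns, because its
characteristic function does. -/
theorem map_sketch_seed_eq {m n k : ℕ} (A : Matrix (Fin m) (Fin n) ℝ) (ρ : ℝ)
    (M : Matrix (Fin m) (Fin m) ℝ) (hM : M * Mᵀ = A * Aᵀ + ρ ^ 2 • (1 : Matrix (Fin m) (Fin m) ℝ)) :
    (seed m n k ρ).map (fun θ => (A * θ.1 + θ.2 : Matrix (Fin m) (Fin k) ℝ)) =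
      (gaussianMatrix m k 1).map (fun H => M * H) := by
  have hmM : Measurable fun H : Matrix (Fin m) (Fin k) ℝ => M * H :=
    measurable_matrix_mul measurable_const measurable_id
  let μ : Measure (Fin m → Fin k → ℝ) := (seed m n k ρ).map
    (fun θ => (A * θ.1 + θ.2 : Matrix (Fin m) (Fin k) ℝ))
  let ν : Measure (Fin m → Fin k → ℝ) := (gaussianMatrix m k 1).map (fun H => M * H)
  have : IsProbabilityMeasure μ :=
    Measure.isProbabilityMeasure_map (measurable_sketch A).aemeasurable
  have : IsProbabilityMeasure ν := Measure.isProbabilityMeasure_map hmM.aemeasurable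
  change μ = ν
  refine Measure.ext_of_charFunDual (E := Fin m → Fin k → ℝ) ?_
  ext L
  have hL : Measurable fun Y : Matrix (Fin m) (Fin k) ℝ => Complex.exp ((L Y : ℂ) * Complex.I) := by
    have : Measurable fun Y : Fin m → Fin k → ℝ => Complex.exp ((L Y : ℂ) * Complex.I) := by
      fun_prop
    exact this
  rw [charFunDual_apply, charFunDual_apply]
  erw [integral_map (measurable_sketch A).aemeasurable hL.aestronglyMeasurable,
    integral_map hmM.aemeasurable hL.aestronglyMeasurable]
  set c : Matrix (Fin m) (Fin k) ℝ := Matrix.of fun i j => L (Pi.single i (Pi.single j 1)) with hc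
  have hLc : ∀ Y : Matrix (Fin m) (Fin k) ℝ, L Y = ∑ i, ∑ j, c i j * Y i j :=
    fun Y => strongDual_pi_pi_apply L Y
  simp_rw [hLc, sum_mul_matrix_mul]
  rw [integral_cexp_gaussianMatrix]
  have h2 : ∀ θ : Matrix (Fin n) (Fin k) ℝ × Matrix (Fin m) (Fin k) ℝ,
      Complex.exp (((∑ i, ∑ j, c i j * (A * θ.1 + θ.2) i j : ℝ) : ℂ) * Complex.I) =
      Complex.exp (((∑ i, ∑ j, (Aᵀ * c) i j * θ.1 i j : ℝ) : ℂ) * Complex.I) *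
      Complex.exp (((∑ i, ∑ j, c i j * θ.2 i j : ℝ) : ℂ) * Complex.I) := by
    intro θ
    rw [← Complex.exp_add, ← add_mul, ← sum_mul_matrix_mul, ← Complex.ofReal_add,
      ← Finset.sum_add_distrib]
    simp_rw [← Finset.sum_add_distrib, Matrix.add_apply, mul_add]
  simp_rw [h2]
  rw [seed, integral_prod_mul
    (fun Z : Matrix (Fin n) (Fin k) ℝ =>
      Complex.exp (((∑ i, ∑ j, (Aᵀ * c) i j * Z i j : ℝ) : ℂ) * Complex.I))
    (fun Z : Matrix (Fin m) (Fin k) ℝ =>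
      Complex.exp (((∑ i, ∑ j, c i j * Z i j : ℝ) : ℂ) * Complex.I)),
    integral_cexp_gaussianMatrix, integral_cexp_gaussianMatrix, ← Complex.exp_add]
  congr 1
  rw [← Complex.ofReal_add]
  congr 1
  have h3 : (∑ i, ∑ j, (Mᵀ * c) i j ^ 2) =
      (∑ i, ∑ j, (Aᵀ * c) i j ^ 2) + ρ ^ 2 * ∑ i, ∑ j, c i j ^ 2 := by
    rw [sum_sq_eq_trace, sum_sq_eq_trace, sum_sq_eq_trace, Matrix.transpose_mul,
      Matrix.transpose_mul, Matrix.transpose_transpose, Matrix.transpose_transpose,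
      Matrix.mul_assoc, ← Matrix.mul_assoc M, hM, Matrix.add_mul, Matrix.mul_add, Matrix.trace_add,
      Matrix.mul_assoc cᵀ A, ← Matrix.mul_assoc A]
    simp
  rw [h3]
  ring

/-- The coordinates of a standard Gaussian vector along an orthonormal family are independent
standard Gaussians. -/
theorem map_inner_pi_gaussianReal {ι κ : Type*} [Fintype ι] [Fintype κ]
    (b : κ → EuclideanSpace ℝ ι) (hb : Orthonormal ℝ b) :
    (Measure.pi fun _ : ι => gaussianReal 0 1).map
      (fun x => fun i => inner ℝ (b i) (WithLp.toLp 2 x)) =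
    Measure.pi fun _ : κ => gaussianReal 0 1 := by
  have hm : Measurable (fun x : ι → ℝ => fun i => inner ℝ (b i) (WithLp.toLp 2 x)) := by
    refine measurable_pi_iff.2 fun i => ?_
    fun_prop
  have := Measure.isProbabilityMeasure_map (μ := Measure.pi fun _ : ι => gaussianReal 0 1)
    hm.aemeasurable
  refine Measure.ext_of_charFunDual (E := κ → ℝ) ?_
  ext L
  classical
  set c : κ → ℝ := fun i => L (Pi.single i 1) with hc
  have hLc : ∀ y : κ → ℝ, L y = ∑ i, c i * y i := by
    intro y
    have h : y = ∑ i, y i • Pi.single i (1 : ℝ) := by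
      ext a
      simp [Finset.sum_apply, Pi.single_apply]
    conv_lhs => rw [h]
    simp [map_sum, mul_comm, hc]
  have hL : Measurable fun y : κ → ℝ => Complex.exp ((L y : ℂ) * Complex.I) := by
    fun_prop
  rw [charFunDual_apply, charFunDual_apply, integral_map hm.aemeasurable hL.aestronglyMeasurable]
  simp_rw [hLc]
  rw [integral_cexp_pi_gaussianReal]
  have h4 : ∀ x : ι → ℝ, ∑ i, c i * inner ℝ (b i) (WithLp.toLp 2 x) =
      ∑ l, (∑ i, c i • b i) l * x l := by
    intro x
    have : ∑ l, (∑ i, c i • b i) l * x l = inner ℝ (∑ i, c i • b i) (WithLp.toLp 2 x) := by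
      simp [PiLp.inner_apply, mul_comm]
    rw [this, sum_inner]
    simp [inner_smul_left]
  simp_rw [h4]
  rw [integral_cexp_pi_gaussianReal]
  congr 5
  have h5 : ∑ l, (∑ i, c i • b i) l ^ 2 = inner ℝ (∑ i, c i • b i) (∑ i, c i • b i) := by
    rw [PiLp.inner_apply]
    simp [sq]
  rw [h5, hb.inner_sum]
  simp [sq]

/-! ### Gram–Schmidt orthonormalization and orthogonal projection -/

/-- The (possibly vanishing) normalized Gram–Schmidt vectors of a family compute the orthogonal
projection onto its span. -/
theorem sum_inner_smul_gramSchmidtNormed {E : Type*} [NormedAddCommGroup E] [InnerProductSpace ℝ E]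
    [FiniteDimensional ℝ E] {s : ℕ} (f : Fin s → E) (x : E) :
    ∑ i, inner ℝ (InnerProductSpace.gramSchmidtNormed ℝ f i) x •
      InnerProductSpace.gramSchmidtNormed ℝ f i =
      (Submodule.span ℝ (Set.range f)).starProjection x := by
  set g := InnerProductSpace.gramSchmidtNormed ℝ f with hg
  have hspan : Submodule.span ℝ (Set.range g) = Submodule.span ℝ (Set.range f) := by
    rw [hg, InnerProductSpace.span_gramSchmidtNormed_range,
      InnerProductSpace.span_gramSchmidt]
  have hort : ∀ i j, i ≠ j → inner ℝ (g i) (g j) = 0 := by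
    intro i j hij
    simp [hg, InnerProductSpace.gramSchmidtNormed, inner_smul_left, inner_smul_right,
      InnerProductSpace.gramSchmidt_orthogonal ℝ f hij]
  refine (Submodule.eq_starProjection_of_mem_of_inner_eq_zero ?_ ?_).symm
  · exact Submodule.sum_mem _ fun i _ => Submodule.smul_mem _ _
      (hspan ▸ Submodule.subset_span (Set.mem_range_self i))
  · intro w hw
    rw [← hspan] at hw
    induction hw using Submodule.span_induction with
    | mem y hy =>
      obtain ⟨j, rfl⟩ := hy
      rw [inner_sub_left, sum_inner, Finset.sum_eq_single j]
      · rw [real_inner_smul_left, real_inner_self_eq_norm_sq]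
        by_cases hj : g j = 0
        · simp [hj]
        · rw [InnerProductSpace.gramSchmidtNormed_unit_length' hj, real_inner_comm]
          simp
      · intro i _ hij
        rw [real_inner_smul_left, hort i j hij, mul_zero]
      · simp
    | zero => simp
    | add y z _ _ hy hz => rw [inner_add_right, hy, hz, add_zero]
    | smul a y _ hy => rw [inner_smul_right, hy, mul_zero]

theorem measurable_gramSchmidtNormed {α : Type*} [MeasurableSpace α] {E : Type*}
    [NormedAddCommGroup E] [InnerProductSpace ℝ E] [FiniteDimensional ℝ E] [MeasurableSpace E]
    [BorelSpace E] {s : ℕ} {f : α → Fin s → E} (hf : ∀ i, Measurable fun x => f x i) (i : Fin s) :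
    Measurable fun x => InnerProductSpace.gramSchmidtNormed ℝ (f x) i := by
  have h : ∀ i : Fin s, Measurable fun x => InnerProductSpace.gramSchmidt ℝ (f x) i := by
    intro i
    induction i using WellFoundedLT.induction with
    | ind i ih =>
      have hdef : (fun x => InnerProductSpace.gramSchmidt ℝ (f x) i) = fun x =>
          f x i - ∑ j ∈ Finset.Iio i, (inner ℝ (InnerProductSpace.gramSchmidt ℝ (f x) j) (f x i) /
            ‖InnerProductSpace.gramSchmidt ℝ (f x) j‖ ^ 2) •
              InnerProductSpace.gramSchmidt ℝ (f x) j := by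
        funext x
        rw [InnerProductSpace.gramSchmidt_def]
        simp [Submodule.starProjection_singleton]
      rw [hdef]
      refine (hf i).sub (Finset.measurable_sum _ fun j hj => ?_)
      have hj' := ih j (Finset.mem_Iio.1 hj)
      exact (((hj'.inner (hf i)).div (hj'.norm.pow_const 2))).smul hj'
  unfold InnerProductSpace.gramSchmidtNormed
  exact ((h i).norm.inv).smul (h i)

/-- The `j`-th column of a matrix, as a vector of the Euclidean space. -/
noncomputable def colVec {m k : ℕ} (Y : Matrix (Fin m) (Fin k) ℝ) (j : Fin k) :
    EuclideanSpace ℝ (Fin m) :=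
  WithLp.toLp 2 fun a => Y a j

theorem measurable_colVec {m k : ℕ} (j : Fin k) :
    Measurable fun Y : Matrix (Fin m) (Fin k) ℝ => colVec Y j :=
  (WithLp.measurable_toLp 2 _).comp (measurable_pi_iff.2 fun a => measurable_apply_apply a j)

theorem measurable_orthonormalizeColumns {m k : ℕ} :
    Measurable (orthonormalizeColumns : Matrix (Fin m) (Fin k) ℝ → Matrix (Fin m) (Fin k) ℝ) := by
  rw [measurable_matrix_iff]
  intro i j
  have h := measurable_gramSchmidtNormed (f := fun (Y : Matrix (Fin m) (Fin k) ℝ) l => colVec Y l)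
    measurable_colVec j
  exact (EuclideanSpace.proj (𝕜 := ℝ) i).continuous.measurable.comp h

theorem frobenius_sq {m k : ℕ} (Z : Matrix (Fin m) (Fin k) ℝ) :
    ‖Z‖ ^ 2 = ∑ i, ∑ j, Z i j ^ 2 := by
  rw [Matrix.frobenius_norm_def, ← Real.sqrt_eq_rpow, Real.sq_sqrt]
  · simp
  · positivity

theorem frobenius_sq_eq_sum_colVec {m k : ℕ} (Z : Matrix (Fin m) (Fin k) ℝ) :
    ‖Z‖ ^ 2 = ∑ j, ‖colVec Z j‖ ^ 2 := by
  rw [frobenius_sq, Finset.sum_comm]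
  simp [EuclideanSpace.norm_sq_eq, colVec]

theorem colVec_orthonormalizeColumns_mul {m k l : ℕ} (Y : Matrix (Fin m) (Fin k) ℝ)
    (Z : Matrix (Fin m) (Fin l) ℝ) (c : Fin l) :
    colVec (orthonormalizeColumns Y * (orthonormalizeColumns Y)ᵀ * Z) c =
      (Submodule.span ℝ (Set.range (colVec Y))).starProjection (colVec Z c) := by
  rw [← sum_inner_smul_gramSchmidtNormed]
  ext a
  rw [Matrix.mul_assoc]
  simp [colVec, Matrix.mul_apply, orthonormalizeColumns, PiLp.inner_apply, mul_comm]
  rfl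

theorem colVec_sub {m k : ℕ} (X Y : Matrix (Fin m) (Fin k) ℝ) (j : Fin k) :
    colVec (X - Y) j = colVec X j - colVec Y j := rfl

/-- `1 - W Wᵀ` is a contraction. -/
theorem norm_sub_projection_le {m k l : ℕ} (Y : Matrix (Fin m) (Fin k) ℝ)
    (Z : Matrix (Fin m) (Fin l) ℝ) :
    ‖Z - orthonormalizeColumns Y * (orthonormalizeColumns Y)ᵀ * Z‖ ≤ ‖Z‖ := by
  refine le_of_sq_le_sq ?_ (norm_nonneg _)
  rw [frobenius_sq_eq_sum_colVec, frobenius_sq_eq_sum_colVec Z]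
  refine Finset.sum_le_sum fun c _ => ?_
  rw [colVec_sub, colVec_orthonormalizeColumns_mul, ← Submodule.starProjection_orthogonal_val]
  gcongr
  exact Submodule.norm_starProjection_apply_le _ _

/-- `W Wᵀ` fixes the columns of `Y`. -/
theorem projection_mul_self {m k : ℕ} (Y : Matrix (Fin m) (Fin k) ℝ) :
    orthonormalizeColumns Y * (orthonormalizeColumns Y)ᵀ * Y = Y := by
  have h : ∀ c, colVec (orthonormalizeColumns Y * (orthonormalizeColumns Y)ᵀ * Y) c =
      colVec Y c := by
    intro c
    rw [colVec_orthonormalizeColumns_mul]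
    exact Submodule.starProjection_eq_self_iff.2 (Submodule.subset_span (Set.mem_range_self c))
  ext a c
  exact congrArg (fun v : EuclideanSpace ℝ (Fin m) => v a) (h c)

theorem measurable_error {m n k : ℕ} (A : Matrix (Fin m) (Fin n) ℝ) :
    Measurable fun Y : Matrix (Fin m) (Fin k) ℝ => error A (orthonormalizeColumns Y) := by
  have hW := measurable_orthonormalizeColumns (m := m) (k := k)
  have hWt : Measurable fun Y : Matrix (Fin m) (Fin k) ℝ => (orthonormalizeColumns Y)ᵀ := by
    rw [measurable_matrix_iff] at hW ⊢
    exact fun i j => hW j i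
  have h := measurable_matrix_mul (measurable_matrix_mul hW hWt)
    (measurable_const (a := A))
  rw [measurable_matrix_iff] at h
  have h2 : ∀ Y : Matrix (Fin m) (Fin k) ℝ, error A (orthonormalizeColumns Y) =
      √(∑ i, ∑ j, (A - orthonormalizeColumns Y * (orthonormalizeColumns Y)ᵀ * A) i j ^ 2) := by
    intro Y
    rw [← frobenius_sq, Real.sqrt_sq (norm_nonneg _), error]
  simp_rw [h2]
  refine Measurable.sqrt (Finset.measurable_sum _ fun i _ => Finset.measurable_sum _ fun j _ => ?_)
  exact (measurable_const.sub (h i j)).pow_const 2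

/-- Since `A Aᵀ ≤ M Mᵀ`, projecting away the range of `Y` leaves at least as much of `M` as of `A`;
and what it leaves of `M` is at most the distance from `M` to any matrix `Y X` with columns in that
range. -/
theorem error_le_of_covariance {m n k l : ℕ} (A : Matrix (Fin m) (Fin n) ℝ) (ρ : ℝ)
    (M : Matrix (Fin m) (Fin l) ℝ) (hM : M * Mᵀ = A * Aᵀ + ρ ^ 2 • (1 : Matrix (Fin m) (Fin m) ℝ))
    (Y : Matrix (Fin m) (Fin k) ℝ) (X : Matrix (Fin k) (Fin l) ℝ) :
    error A (orthonormalizeColumns Y) ≤ ‖M - Y * X‖ := by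
  set P := orthonormalizeColumns Y * (orthonormalizeColumns Y)ᵀ with hP
  have key : ∀ (b : ℕ) (R : Matrix (Fin m) (Fin m) ℝ) (Z : Matrix (Fin m) (Fin b) ℝ),
      ‖R * Z‖ ^ 2 = (R * (Z * Zᵀ) * Rᵀ).trace := by
    intro b R Z
    rw [frobenius_sq, sum_sq_eq_trace, Matrix.trace_mul_comm, Matrix.transpose_mul]
    simp only [Matrix.mul_assoc]
  have h1 : ‖A - P * A‖ ≤ ‖M - P * M‖ := by
    refine le_of_sq_le_sq ?_ (norm_nonneg _)
    have hA : A - P * A = (1 - P) * A := by rw [Matrix.sub_mul, Matrix.one_mul]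
    have hM' : M - P * M = (1 - P) * M := by rw [Matrix.sub_mul, Matrix.one_mul]
    rw [hA, hM', key, key, hM, Matrix.mul_add, Matrix.add_mul, Matrix.trace_add]
    have h2 : ((1 - P) * (ρ ^ 2 • (1 : Matrix (Fin m) (Fin m) ℝ)) * (1 - P)ᵀ).trace =
        ρ ^ 2 * ‖1 - P‖ ^ 2 := by
      rw [frobenius_sq, sum_sq_eq_trace, Matrix.trace_mul_comm (1 - P)ᵀ]
      simp
    rw [h2]
    have : 0 ≤ ρ ^ 2 * ‖1 - P‖ ^ 2 := by positivity
    linarith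
  have h3 : M - P * M = (M - Y * X) - P * (M - Y * X) := by
    rw [Matrix.mul_sub, ← Matrix.mul_assoc, hP, projection_mul_self]
    abel
  calc error A (orthonormalizeColumns Y) = ‖A - P * A‖ := rfl
    _ ≤ ‖M - P * M‖ := h1
    _ = ‖(M - Y * X) - P * (M - Y * X)‖ := by rw [← h3]
    _ ≤ ‖M - Y * X‖ := norm_sub_projection_le Y _

/-! ### Left singular vectors -/

theorem singularValue_nonneg {m n : ℕ} (A : Matrix (Fin m) (Fin n) ℝ) (j : ℕ) :
    0 ≤ singularValue A j :=
  LinearMap.singularValues_nonneg _ j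

theorem inner_map_eigenvectorBasis {m n : ℕ}
    (T : EuclideanSpace ℝ (Fin n) →ₗ[ℝ] EuclideanSpace ℝ (Fin m)) (i j : Fin n) :
    inner ℝ (T (T.isSymmetric_adjoint_comp_self.eigenvectorBasis finrank_euclideanSpace_fin i))
      (T (T.isSymmetric_adjoint_comp_self.eigenvectorBasis finrank_euclideanSpace_fin j)) =
      if i = j then T.singularValues i ^ 2 else 0 := by
  set v := T.isSymmetric_adjoint_comp_self.eigenvectorBasis finrank_euclideanSpace_fin with hv
  have h := T.isSymmetric_adjoint_comp_self.apply_eigenvectorBasis finrank_euclideanSpace_fin j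
  rw [← hv] at h
  rw [← LinearMap.adjoint_inner_right, ← LinearMap.comp_apply, h, inner_smul_right,
    v.inner_eq_ite, ← T.sq_singularValues_fin finrank_euclideanSpace_fin j]
  split_ifs with hij
  · subst hij; simp
  · simp

/-- Left singular vectors: the normalized images of the right singular vectors with nonzero singular
value, completed to an orthonormal basis. -/
theorem exists_orthonormalBasis_singular {m n : ℕ}
    (T : EuclideanSpace ℝ (Fin n) →ₗ[ℝ] EuclideanSpace ℝ (Fin m)) :
    ∃ b : OrthonormalBasis (Fin m) ℝ (EuclideanSpace ℝ (Fin m)),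
      ∀ i j, inner ℝ (T.adjoint (b i)) (T.adjoint (b j)) =
        if i = j then T.singularValues i ^ 2 else 0 := by
  set v := T.isSymmetric_adjoint_comp_self.eigenvectorBasis finrank_euclideanSpace_fin with hv
  have hin := inner_map_eigenvectorBasis T
  rw [← hv] at hin
  let w : Fin m → EuclideanSpace ℝ (Fin m) := fun j =>
    if h : (j : ℕ) < n then (T.singularValues j)⁻¹ • T (v ⟨j, h⟩) else 0
  let s : Set (Fin m) := {j | T.singularValues j ≠ 0}
  have hlt : ∀ j ∈ s, (j : ℕ) < n := by
    intro j hj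
    by_contra hjn
    exact hj (T.singularValues_of_finrank_le (by simpa using hjn))
  have hw : Orthonormal ℝ (s.domRestrict w) := by
    rw [orthonormal_iff_ite]
    rintro ⟨i, hi⟩ ⟨j, hj⟩
    have hi' : T.singularValues i ≠ 0 := hi
    simp only [Set.domRestrict_apply, w, hlt i hi, hlt j hj, dite_true, inner_smul_left,
      inner_smul_right, hin, Subtype.mk.injEq, Fin.mk.injEq, Fin.val_inj]
    split_ifs with hij
    · subst hij
      simp
      field_simp
    · simp
  obtain ⟨b, hb⟩ := hw.exists_orthonormalBasis_extension_of_card_eq (by simp)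
  -- the image of a right singular vector is a multiple of the matching left one
  have hTv : ∀ l : Fin n, ∀ j : Fin m,
      inner ℝ (b j) (T (v l)) = if (l : ℕ) = j then T.singularValues j else 0 := by
    intro l j
    by_cases hl : T.singularValues l = 0
    · have h0 : T (v l) = 0 := by
        rw [← inner_self_eq_zero (𝕜 := ℝ), hin]
        simp [hl]
      rw [h0, inner_zero_right]
      split_ifs with h
      · rw [← h, hl]
      · rfl
    · have hlm : (l : ℕ) < m := by
        have h1 := T.singularValues_pos_iff_lt_finrank_range.1
          ((T.singularValues_pos_iff_ne_zero l).2 hl)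
        have h2 := T.range.finrank_le
        simp only [finrank_euclideanSpace, Fintype.card_fin] at h2
        omega
      have h3 : T (v l) = T.singularValues l • b ⟨l, hlm⟩ := by
        rw [hb ⟨l, hlm⟩ hl]
        simp only [w, l.2, dite_true]
        rw [smul_smul, mul_inv_cancel₀ hl, one_smul]
      rw [h3, inner_smul_right, b.inner_eq_ite]
      by_cases h : (l : ℕ) = j
      · have : j = ⟨l, hlm⟩ := Fin.ext h.symm
        simp [this]
      · have : j ≠ ⟨l, hlm⟩ := fun h' => h (by rw [h'])
        simp [this, h]
  refine ⟨b, fun i j => ?_⟩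
  rw [← v.sum_inner_mul_inner]
  simp_rw [LinearMap.adjoint_inner_left, LinearMap.adjoint_inner_right,
    real_inner_comm (b _) (T _), hTv]
  by_cases hij : i = j
  · subst hij
    by_cases hn : (i : ℕ) < n
    · rw [Finset.sum_eq_single ⟨i, hn⟩]
      · simp [sq]
      · intro l _ hl
        have : (l : ℕ) ≠ i := fun h => hl (Fin.ext h)
        simp [this]
      · simp
    · rw [T.singularValues_of_finrank_le (by simpa using hn)]
      simp
  · rw [if_neg hij]
    refine Finset.sum_eq_zero fun l _ => ?_
    have : (i : ℕ) ≠ j := fun h => hij (Fin.ext h)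
    split_ifs with h1 h2 <;> first | omega | simp

/-- The spectral decomposition of `A Aᵀ`, with the squared singular values in decreasing order. -/
theorem exists_left_singular_matrix {m n : ℕ} (A : Matrix (Fin m) (Fin n) ℝ) :
    ∃ U : Matrix (Fin m) (Fin m) ℝ, Uᵀ * U = 1 ∧
      A * Aᵀ = U * Matrix.diagonal (fun j : Fin m => singularValue A j ^ 2) * Uᵀ := by
  obtain ⟨b, hb⟩ := exists_orthonormalBasis_singular (Matrix.toEuclideanLin A)
  rw [← Matrix.toEuclideanLin_conjTranspose_eq_adjoint] at hb
  let U : Matrix (Fin m) (Fin m) ℝ := Matrix.of fun a j => b j a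
  have hU : Uᵀ * U = 1 := by
    ext i j
    have := b.inner_eq_ite i j
    simpa [U, Matrix.mul_apply, PiLp.inner_apply, mul_comm, Matrix.one_apply] using this
  have hU' : U * Uᵀ = 1 := mul_eq_one_comm.1 hU
  refine ⟨U, hU, ?_⟩
  have h : Uᵀ * (A * Aᵀ) * U = Matrix.diagonal (fun j : Fin m => singularValue A j ^ 2) := by
    have h1 : Uᵀ * (A * Aᵀ) * U = (Aᵀ * U)ᵀ * (Aᵀ * U) := by
      simp [Matrix.mul_assoc]
    rw [h1]
    ext i j
    have h2 := hb i j
    have h3 : ∀ l c, (Matrix.toEuclideanLin Aᴴ (b l)) c = (Aᵀ * U) c l := by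
      intro l c
      simp [U, Matrix.mul_apply, Matrix.mulVec, dotProduct]
    rw [PiLp.inner_apply] at h2
    simp only [h3] at h2
    rw [Matrix.mul_apply, Matrix.diagonal_apply]
    simpa [mul_comm, singularValue] using h2
  calc A * Aᵀ = (U * Uᵀ) * (A * Aᵀ) * (U * Uᵀ) := by rw [hU']; simp
    _ = U * (Uᵀ * (A * Aᵀ) * U) * Uᵀ := by simp only [Matrix.mul_assoc]
    _ = _ := by rw [h]

theorem frobenius_sq_eq_sum_singularValue {m n : ℕ} (A : Matrix (Fin m) (Fin n) ℝ) :
    ‖A‖ ^ 2 = ∑ j ∈ Finset.range m, singularValue A j ^ 2 := by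
  obtain ⟨U, hU, hA⟩ := exists_left_singular_matrix A
  rw [frobenius_sq, sum_sq_eq_trace, Matrix.trace_mul_comm, hA, Matrix.trace_mul_comm,
    ← Matrix.mul_assoc, hU, Matrix.one_mul, Matrix.trace_diagonal,
    Finset.sum_range (fun j => singularValue A j ^ 2)]

/-- A square root of `A Aᵀ + ρ² 1` with orthogonal columns of lengths `√(σⱼ² + ρ²)`. -/
theorem exists_sqrt_covariance {m n : ℕ} (A : Matrix (Fin m) (Fin n) ℝ) (ρ : ℝ) :
    ∃ U : Matrix (Fin m) (Fin m) ℝ, Uᵀ * U = 1 ∧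
      (U * Matrix.diagonal (fun j : Fin m => √(singularValue A j ^ 2 + ρ ^ 2))) *
        (U * Matrix.diagonal (fun j : Fin m => √(singularValue A j ^ 2 + ρ ^ 2)))ᵀ =
        A * Aᵀ + ρ ^ 2 • (1 : Matrix (Fin m) (Fin m) ℝ) := by
  obtain ⟨U, hU, hA⟩ := exists_left_singular_matrix A
  refine ⟨U, hU, ?_⟩
  have hU' : U * Uᵀ = 1 := mul_eq_one_comm.1 hU
  have hd : Matrix.diagonal (fun j : Fin m => √(singularValue A j ^ 2 + ρ ^ 2)) *
      Matrix.diagonal (fun j : Fin m => √(singularValue A j ^ 2 + ρ ^ 2)) =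
      Matrix.diagonal (fun j : Fin m => singularValue A j ^ 2) +
        ρ ^ 2 • (1 : Matrix (Fin m) (Fin m) ℝ) := by
    rw [Matrix.diagonal_mul_diagonal]
    ext i j
    by_cases hij : i = j
    · subst hij
      simp only [Matrix.diagonal_apply_eq, Matrix.add_apply, Matrix.smul_apply, Matrix.one_apply_eq,
        smul_eq_mul, mul_one]
      exact Real.mul_self_sqrt (by positivity)
    · simp [hij]
  rw [Matrix.transpose_mul, Matrix.diagonal_transpose, Matrix.mul_assoc,
    ← Matrix.mul_assoc (Matrix.diagonal _) (Matrix.diagonal _), hd, Matrix.add_mul, Matrix.mul_add,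
    ← Matrix.mul_assoc, ← hA]
  congr 1
  simp [hU']

theorem frobenius_orthogonal_mul {m k : ℕ} {U : Matrix (Fin m) (Fin m) ℝ} (hU : Uᵀ * U = 1)
    (Z : Matrix (Fin m) (Fin k) ℝ) : ‖U * Z‖ ^ 2 = ‖Z‖ ^ 2 := by
  rw [frobenius_sq, frobenius_sq, sum_sq_eq_trace, sum_sq_eq_trace, Matrix.transpose_mul,
    Matrix.mul_assoc, ← Matrix.mul_assoc Uᵀ, hU, Matrix.one_mul]

/-! ### Moments of Gaussian vectors -/

/-- In an integral over a product of probability spaces, one coordinate may be integrated first. -/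
theorem lintegral_pi_update {ι : Type*} [Fintype ι] [DecidableEq ι] {X : ι → Type*}
    [∀ i, MeasurableSpace (X i)] (μ : ∀ i, Measure (X i)) [∀ i, IsProbabilityMeasure (μ i)]
    (i : ι) {F : (∀ i, X i) → ENNReal} (hF : Measurable F) :
    ∫⁻ x, F x ∂(Measure.pi μ) =
      ∫⁻ x, ∫⁻ y, F (Function.update x i y) ∂(μ i) ∂(Measure.pi μ) := by
  have h1 : Measurable fun x : ∀ i, X i => ∫⁻ y, F (Function.update x i y) ∂(μ i) := by
    have := hF.lmarginal μ (s := {i})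
    rwa [lmarginal_singleton] at this
  refine lintegral_eq_of_lmarginal_eq {i} hF h1 ?_
  rw [lmarginal_singleton, lmarginal_singleton]
  simp

/-- A linear functional of a standard Gaussian vector is Gaussian, its variance being the squared norm
of the functional. -/
theorem map_inner_pi_eq_gaussianReal {ι : Type*} [Fintype ι] (a : EuclideanSpace ℝ ι) :
    (Measure.pi fun _ : ι => gaussianReal 0 1).map (fun x => inner ℝ a (WithLp.toLp 2 x)) =
      gaussianReal 0 (Real.toNNReal (‖a‖ ^ 2)) := by
  by_cases ha : a = 0
  · subst ha
    simp
  have hn : ‖a‖ ≠ 0 := norm_ne_zero_iff.2 ha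
  have hu : Orthonormal ℝ (fun _ : Unit => ‖a‖⁻¹ • a) :=
    ⟨fun _ => by rw [norm_smul, norm_inv, norm_norm, inv_mul_cancel₀ hn],
      fun i j hij => (hij (Subsingleton.elim _ _)).elim⟩
  have h := map_inner_pi_gaussianReal _ hu
  have h2 : (fun x : ι → ℝ => inner ℝ a (WithLp.toLp 2 x)) =
      (fun y : Unit → ℝ => ‖a‖ * y ()) ∘
        (fun x : ι → ℝ => fun _ : Unit => inner ℝ (‖a‖⁻¹ • a) (WithLp.toLp 2 x)) := by
    funext x
    simp only [Function.comp, real_inner_smul_left]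
    rw [← mul_assoc, mul_inv_cancel₀ hn, one_mul]
  have hm : Measurable (fun x : ι → ℝ => fun _ : Unit =>
      inner ℝ (‖a‖⁻¹ • a) (WithLp.toLp 2 x)) := by
    refine measurable_pi_iff.2 fun i => ?_
    fun_prop
  rw [h2, ← Measure.map_map (by fun_prop) hm, h]
  have h3 : (fun y : Unit → ℝ => ‖a‖ * y ()) = (fun y : ℝ => ‖a‖ * y) ∘ Function.eval () := rfl
  rw [h3, ← Measure.map_map (by fun_prop) (by fun_prop),
    (measurePreserving_eval (fun _ : Unit => gaussianReal 0 1) ()).map_eq,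
    gaussianReal_map_const_mul]
  congr 1
  · simp
  · ext
    simp

theorem lintegral_sq_gaussianReal (v : NNReal) :
    ∫⁻ y, ENNReal.ofReal (y ^ 2) ∂(gaussianReal 0 v) = v := by
  have hv := variance_fun_id_gaussianReal (μ := 0) (v := v)
  have hL : MemLp (fun x : ℝ => x) 2 (gaussianReal 0 v) := memLp_id_gaussianReal 2
  rw [variance_eq_sub hL] at hv
  simp only [Pi.pow_apply, integral_id_gaussianReal] at hv
  rw [← ofReal_integral_eq_lintegral_ofReal hL.integrable_sq (Filter.Eventually.of_forall
    fun x => sq_nonneg x)]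
  have : ∫ x, x ^ 2 ∂(gaussianReal 0 v) = v := by simpa using hv
  rw [this, ENNReal.ofReal_coe_nnreal]

theorem lintegral_inner_sq {ι : Type*} [Fintype ι] (a : EuclideanSpace ℝ ι) :
    ∫⁻ x, ENNReal.ofReal (inner ℝ a (WithLp.toLp 2 x) ^ 2)
      ∂(Measure.pi fun _ : ι => gaussianReal 0 1) = ENNReal.ofReal (‖a‖ ^ 2) := by
  have h := lintegral_sq_gaussianReal (Real.toNNReal (‖a‖ ^ 2))
  rw [← map_inner_pi_eq_gaussianReal, lintegral_map (by fun_prop) (by fun_prop)] at h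
  exact h

theorem integral_exp_neg_mul_sq_gaussianReal {t : ℝ} (ht : 0 ≤ t) :
    ∫ y, Real.exp (-t * y ^ 2) ∂(gaussianReal 0 1) = (1 + 2 * t) ^ (-(1 / 2) : ℝ) := by
  rw [integral_gaussianReal_eq_integral_smul one_ne_zero]
  have h : ∀ y : ℝ, gaussianPDFReal 0 1 y • Real.exp (-t * y ^ 2) =
      (√(2 * Real.pi))⁻¹ * Real.exp (-(t + 1 / 2) * y ^ 2) := by
    intro y
    rw [gaussianPDFReal, smul_eq_mul, mul_assoc, ← Real.exp_add]
    simp only [NNReal.coe_one, mul_one, sub_zero]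
    ring_nf
  simp_rw [h]
  rw [integral_const_mul, integral_gaussian, ← Real.sqrt_inv, ← Real.sqrt_mul (by positivity),
    Real.rpow_neg (by positivity), ← Real.sqrt_eq_rpow, ← Real.sqrt_inv]
  congr 1
  have := Real.pi_pos
  field_simp
  ring

theorem inv_eq_lintegral_exp {s : ℝ} (hs : 0 ≤ s) :
    (ENNReal.ofReal s)⁻¹ = ∫⁻ t in Set.Ioi (0 : ℝ), ENNReal.ofReal (Real.exp (-t * s)) := by
  rcases hs.eq_or_lt with rfl | hs
  · simp
  · have h1 : ∀ t : ℝ, -t * s = -s * t := fun t => by ring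
    simp_rw [h1]
    rw [← ofReal_integral_eq_lintegral_ofReal (integrableOn_exp_mul_Ioi (by linarith) 0)
      (Filter.Eventually.of_forall fun x => (Real.exp_pos _).le),
      integral_exp_mul_Ioi (by linarith), ← ENNReal.ofReal_inv_of_pos hs]
    congr 1
    simp

theorem lintegral_rpow_Ioi {d : ℝ} (hd : 2 < d) :
    ∫⁻ t in Set.Ioi (0 : ℝ), ENNReal.ofReal ((1 + 2 * t) ^ (-(d / 2))) =
      ENNReal.ofReal (1 / (d - 2)) := by
  have hderiv : ∀ x ∈ Set.Ici (0 : ℝ), HasDerivAt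
      (fun t : ℝ => -(1 / (d - 2)) * (1 + 2 * t) ^ (1 - d / 2)) ((1 + 2 * x) ^ (-(d / 2))) x := by
    intro x hx
    have hx' : (0 : ℝ) ≤ x := hx
    have h1 : HasDerivAt (fun t : ℝ => 1 + 2 * t) 2 x := by
      simpa using ((hasDerivAt_id x).const_mul 2).const_add 1
    have h2 := (h1.rpow_const (p := 1 - d / 2) (Or.inl (by positivity))).const_mul (-(1 / (d - 2)))
    have h3 : d - 2 ≠ 0 := by linarith
    rw [show 1 - d / 2 - 1 = -(d / 2) by ring, ← mul_assoc,
      show -(1 / (d - 2)) * (2 * (1 - d / 2)) = 1 by field_simp; ring, one_mul] at h2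
    exact h2
  have hlim : Filter.Tendsto (fun t : ℝ => -(1 / (d - 2)) * (1 + 2 * t) ^ (1 - d / 2))
      Filter.atTop (nhds 0) := by
    have h1 : Filter.Tendsto (fun t : ℝ => 1 + 2 * t) Filter.atTop Filter.atTop :=
      Filter.tendsto_atTop_add_const_left _ _ (Filter.tendsto_id.const_mul_atTop two_pos)
    have h2 := (tendsto_rpow_neg_atTop (y := d / 2 - 1) (by linarith)).comp h1
    have h3 := h2.const_mul (-(1 / (d - 2)))
    rw [mul_zero] at h3
    refine h3.congr fun t => ?_
    simp
  have hnn : ∀ x ∈ Set.Ioi (0 : ℝ), (0 : ℝ) ≤ (1 + 2 * x) ^ (-(d / 2)) := by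
    intro x hx
    have hx' : (0 : ℝ) < x := hx
    positivity
  have hint := integrableOn_Ioi_deriv_of_nonneg' hderiv hnn hlim
  rw [← ofReal_integral_eq_lintegral_ofReal hint
    ((ae_restrict_iff' measurableSet_Ioi).2 (Filter.Eventually.of_forall hnn)),
    integral_Ioi_of_hasDerivAt_of_tendsto' hderiv hint hlim]
  simp

/-- The expected inverse of a chi-square variable with `d > 2` degrees of freedom, computed from
`1 / s = ∫₀^∞ exp (- t s) dt`. -/
theorem lintegral_inv_sum_sq {d : ℕ} (hd : 2 < d) :
    ∫⁻ y, (ENNReal.ofReal (∑ i, y i ^ 2))⁻¹ ∂(Measure.pi fun _ : Fin d => gaussianReal 0 1) =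
      ENNReal.ofReal (1 / ((d : ℝ) - 2)) := by
  have h1 : ∀ y : Fin d → ℝ, (ENNReal.ofReal (∑ i, y i ^ 2))⁻¹ =
      ∫⁻ t in Set.Ioi (0 : ℝ), ENNReal.ofReal (Real.exp (-t * ∑ i, y i ^ 2)) := fun y =>
    inv_eq_lintegral_exp (by positivity)
  simp_rw [h1]
  rw [lintegral_lintegral_swap (by fun_prop), ← lintegral_rpow_Ioi (by exact_mod_cast hd)]
  refine setLIntegral_congr_fun measurableSet_Ioi fun t ht => ?_
  have ht' : (0 : ℝ) ≤ t := le_of_lt ht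
  have h2 : ∀ y : Fin d → ℝ, Real.exp (-t * ∑ i, y i ^ 2) = ∏ i, Real.exp (-t * y i ^ 2) := by
    intro y
    rw [← Real.exp_sum, Finset.mul_sum]
  have h3 : ∫ y : Fin d → ℝ, Real.exp (-t * ∑ i, y i ^ 2)
      ∂(Measure.pi fun _ : Fin d => gaussianReal 0 1) = (1 + 2 * t) ^ (-((d : ℝ) / 2)) := by
    simp_rw [h2]
    rw [integral_fintype_prod_eq_pow (𝕜 := ℝ) (fun y => Real.exp (-t * y ^ 2)),
      integral_exp_neg_mul_sq_gaussianReal ht', ← Real.rpow_natCast, ← Real.rpow_mul (by positivity)]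
    congr 1
    simp
    ring
  rw [← h3, ofReal_integral_eq_lintegral_ofReal _ (Filter.Eventually.of_forall fun x =>
    (Real.exp_pos _).le)]
  refine Integrable.of_bound (C := 1)
    (Measurable.aestronglyMeasurable (by fun_prop)) (Filter.Eventually.of_forall fun y => ?_)
  rw [Real.norm_eq_abs, Real.abs_exp, Real.exp_le_one_iff]
  have : 0 ≤ ∑ i, y i ^ 2 := by positivity
  nlinarith

/-- The expected inverse squared distance of a standard Gaussian vector to a subspace of codimension
at least `p + 1`. -/
theorem lintegral_inv_dist_sq_le {k p : ℕ} (hp : 2 ≤ p)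
    (S : Submodule ℝ (EuclideanSpace ℝ (Fin k))) (hS : Module.finrank ℝ S + p + 1 ≤ k) :
    ∫⁻ x, (ENNReal.ofReal (‖WithLp.toLp 2 x - S.starProjection (WithLp.toLp 2 x)‖ ^ 2))⁻¹
      ∂(Measure.pi fun _ : Fin k => gaussianReal 0 1) ≤ ENNReal.ofReal (1 / ((p : ℝ) - 1)) := by
  have hd := S.finrank_add_finrank_orthogonal
  rw [finrank_euclideanSpace_fin] at hd
  set d := Module.finrank ℝ Sᗮ with hd_def
  let b := stdOrthonormalBasis ℝ Sᗮ
  let b' : Fin d → EuclideanSpace ℝ (Fin k) := fun i => (b i : EuclideanSpace ℝ (Fin k))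
  have hb' : Orthonormal ℝ b' := b.orthonormal.comp_linearIsometry Sᗮ.subtypeₗᵢ
  have h1 : ∀ z : EuclideanSpace ℝ (Fin k), ‖z - S.starProjection z‖ ^ 2 =
      ∑ i, inner ℝ (b' i) z ^ 2 := by
    intro z
    rw [← Submodule.starProjection_orthogonal_val, Submodule.starProjection_apply]
    rw [← Submodule.coe_norm, ← b.sum_sq_norm_inner_right]
    refine Finset.sum_congr rfl fun i _ => ?_
    rw [Real.norm_eq_abs, sq_abs]
    congr 1
    exact Submodule.inner_orthogonalProjectionOnto_eq_of_mem_left (b i) z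
  have hm : Measurable (fun x : Fin k → ℝ => fun i => inner ℝ (b' i) (WithLp.toLp 2 x)) := by
    refine measurable_pi_iff.2 fun i => ?_
    fun_prop
  have h2 := lintegral_inv_sum_sq (d := d) (by omega)
  rw [← map_inner_pi_gaussianReal b' hb', lintegral_map (by fun_prop) hm] at h2
  simp_rw [h1]
  rw [h2]
  refine ENNReal.ofReal_le_ofReal (one_div_le_one_div_of_le ?_ ?_)
  · have : (2 : ℝ) ≤ p := by exact_mod_cast hp
    linarith
  · have : (p : ℝ) + 1 ≤ d := by exact_mod_cast (by omega : p + 1 ≤ d)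
    linarith

/-! ### The dual basis of the leading rows of a Gaussian matrix -/

/-- The `i`-th row of a matrix, as a vector of the Euclidean space. -/
noncomputable def rowVec {m k : ℕ} (H : Matrix (Fin m) (Fin k) ℝ) (i : Fin m) :
    EuclideanSpace ℝ (Fin k) :=
  WithLp.toLp 2 (H i)

/-- The first `r` rows of `H` other than row `i`, with all remaining rows replaced by `0`. -/
noncomputable def otherRows {m k : ℕ} (r : ℕ) (H : Matrix (Fin m) (Fin k) ℝ) (i l : Fin m) :
    EuclideanSpace ℝ (Fin k) :=
  if (l : ℕ) < r ∧ l ≠ i then rowVec H l else 0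

/-- The component of row `i` of `H` orthogonal to the other ones among the first `r` rows. -/
noncomputable def residual {m k : ℕ} (r : ℕ) (H : Matrix (Fin m) (Fin k) ℝ) (i : Fin m) :
    EuclideanSpace ℝ (Fin k) :=
  rowVec H i - (Submodule.span ℝ (Set.range (otherRows r H i))).starProjection (rowVec H i)

/-- The rescaled residuals. If no residual vanishes, they form the basis dual to the first `r` rows
of `H`, that is, the columns of the pseudoinverse of the matrix of these rows. -/
noncomputable def dualVec {m k : ℕ} (r : ℕ) (H : Matrix (Fin m) (Fin k) ℝ) (i : Fin m) :
    EuclideanSpace ℝ (Fin k) :=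
  (‖residual r H i‖ ^ 2)⁻¹ • residual r H i

theorem measurable_rowVec {m k : ℕ} (i : Fin m) :
    Measurable fun H : Matrix (Fin m) (Fin k) ℝ => rowVec H i :=
  (WithLp.measurable_toLp 2 _).comp (measurable_pi_apply (X := fun _ : Fin m => Fin k → ℝ) i)

theorem measurable_residual {m k : ℕ} (r : ℕ) (i : Fin m) :
    Measurable fun H : Matrix (Fin m) (Fin k) ℝ => residual r H i := by
  unfold residual
  simp_rw [← sum_inner_smul_gramSchmidtNormed]
  have h : ∀ l, Measurable fun H : Matrix (Fin m) (Fin k) ℝ =>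
      InnerProductSpace.gramSchmidtNormed ℝ (otherRows r H i) l := by
    refine measurable_gramSchmidtNormed fun l => ?_
    unfold otherRows
    split_ifs
    · exact measurable_rowVec l
    · exact measurable_const
  refine (measurable_rowVec i).sub (Finset.measurable_sum _ fun l _ => ?_)
  exact Measurable.smul (f := fun H => inner ℝ
    (InnerProductSpace.gramSchmidtNormed ℝ (otherRows r H i) l) (rowVec H i))
    ((h l).inner (measurable_rowVec i)) (h l)

theorem measurable_dualVec {m k : ℕ} (r : ℕ) (i : Fin m) :
    Measurable fun H : Matrix (Fin m) (Fin k) ℝ => dualVec r H i :=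
  ((measurable_residual r i).norm.pow_const 2).inv.smul (measurable_residual r i)

theorem inner_dualVec_rowVec {m k r : ℕ} {H : Matrix (Fin m) (Fin k) ℝ} {i j : Fin m}
    (hi : residual r H i ≠ 0) (hj : (j : ℕ) < r) :
    inner ℝ (dualVec r H i) (rowVec H j) = if j = i then 1 else 0 := by
  set S := Submodule.span ℝ (Set.range (otherRows r H i)) with hS
  have hort : residual r H i ∈ Sᗮ := S.sub_starProjection_mem_orthogonal _
  rw [real_inner_comm, dualVec, real_inner_smul_right]
  split_ifs with h
  · subst h
    have h1 : rowVec H j = residual r H j + S.starProjection (rowVec H j) := by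
      rw [residual, sub_add_cancel]
    rw [h1, inner_add_left, hort _ (S.starProjection_apply_mem _), add_zero,
      real_inner_self_eq_norm_sq, inv_mul_cancel₀]
    exact pow_ne_zero 2 (norm_ne_zero_iff.2 hi)
  · have h1 : rowVec H j ∈ S := by
      refine Submodule.subset_span ⟨j, ?_⟩
      rw [otherRows, if_pos ⟨hj, h⟩]
    rw [hort _ h1, mul_zero]

theorem rowVec_update_self {m k : ℕ} (H : Matrix (Fin m) (Fin k) ℝ) (i : Fin m)
    (y : Fin k → ℝ) :
    rowVec (H.updateRow i y) i = WithLp.toLp 2 y := by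
  rw [rowVec, Matrix.updateRow_self]

theorem rowVec_update_of_ne {m k : ℕ} (H : Matrix (Fin m) (Fin k) ℝ) {i j : Fin m} (hij : j ≠ i)
    (y : Fin k → ℝ) :
    rowVec (H.updateRow i y) j = rowVec H j := by
  simp only [rowVec, Matrix.updateRow_ne hij]

theorem otherRows_update_self {m k : ℕ} (r : ℕ) (H : Matrix (Fin m) (Fin k) ℝ) (i : Fin m)
    (y : Fin k → ℝ) :
    otherRows r (H.updateRow i y) i = otherRows r H i := by
  funext l
  unfold otherRows
  split_ifs with h
  · exact rowVec_update_of_ne H h.2 y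
  · rfl

theorem residual_update_of_le {m k r : ℕ} (H : Matrix (Fin m) (Fin k) ℝ) {i j : Fin m}
    (hi : (i : ℕ) < r) (hj : r ≤ (j : ℕ)) (y : Fin k → ℝ) :
    residual r (H.updateRow j y) i = residual r H i := by
  have h1 : otherRows r (H.updateRow j y) i =
      otherRows r H i := by
    funext l
    unfold otherRows
    split_ifs with h
    · exact rowVec_update_of_ne H (fun h' => by subst h'; omega) y
    · rfl
  have hij : i ≠ j := fun h' => by subst h'; omega
  simp only [residual, h1, rowVec_update_of_ne H hij]

theorem finrank_span_otherRows_lt {m k r : ℕ} (H : Matrix (Fin m) (Fin k) ℝ) {i : Fin m}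
    (hi : (i : ℕ) < r) :
    Module.finrank ℝ (Submodule.span ℝ (Set.range (otherRows r H i))) < r := by
  classical
  let F : Finset (Fin m) := Finset.univ.filter fun l => (l : ℕ) < r ∧ l ≠ i
  have h1 : Submodule.span ℝ (Set.range (otherRows r H i)) ≤
      Submodule.span ℝ ((F.image (rowVec H) : Finset _) : Set (EuclideanSpace ℝ (Fin k))) := by
    refine Submodule.span_le.2 ?_
    rintro _ ⟨l, rfl⟩
    unfold otherRows
    split_ifs with h
    · exact Submodule.subset_span (Finset.mem_coe.2 (Finset.mem_image_of_mem _ (by simp [F, h])))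
    · exact Submodule.zero_mem _
  have h2 : F.card < r := by
    have h3 : (F.map Fin.valEmbedding) ⊆ (Finset.range r).erase i := by
      intro a ha
      obtain ⟨l, hl, rfl⟩ := Finset.mem_map.1 ha
      have hl' : (l : ℕ) < r ∧ l ≠ i := by simpa [F] using hl
      simp only [Fin.valEmbedding_apply, Finset.mem_erase, Finset.mem_range]
      exact ⟨fun h => hl'.2 (Fin.ext h), hl'.1⟩
    have h4 := Finset.card_le_card h3
    rw [Finset.card_map, Finset.card_erase_of_mem (Finset.mem_range.2 hi), Finset.card_range] at h4
    omega
  calc _ ≤ _ := Submodule.finrank_mono h1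
    _ ≤ _ := finrank_span_finset_le_card _
    _ ≤ _ := Finset.card_image_le
    _ < r := h2

theorem gaussianMatrix_one (m k : ℕ) :
    gaussianMatrix m k 1 = (Measure.pi fun _ : Fin m => Measure.pi fun _ : Fin k =>
      gaussianReal 0 1 : Measure (Fin m → Fin k → ℝ)) := by
  simp only [gaussianMatrix, one_pow, Real.toNNReal_one]
  rfl

theorem lintegral_gaussianMatrix_update {m k : ℕ} (i : Fin m)
    {F : Matrix (Fin m) (Fin k) ℝ → ENNReal} (hF : Measurable F) :
    ∫⁻ H, F H ∂(gaussianMatrix m k 1) =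
      ∫⁻ H, ∫⁻ y, F (H.updateRow i y)
        ∂(Measure.pi fun _ : Fin k => gaussianReal 0 1) ∂(gaussianMatrix m k 1) := by
  rw [gaussianMatrix_one]
  exact lintegral_pi_update (fun _ : Fin m => Measure.pi fun _ : Fin k => gaussianReal 0 1) i hF

theorem lintegral_inv_residual_le {m k r p : ℕ} (hp : 2 ≤ p) (hk : r + p ≤ k) {i : Fin m}
    (hi : (i : ℕ) < r) :
    ∫⁻ H, (ENNReal.ofReal (‖residual r H i‖ ^ 2))⁻¹ ∂(gaussianMatrix m k 1) ≤
      ENNReal.ofReal (1 / ((p : ℝ) - 1)) := by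
  rw [lintegral_gaussianMatrix_update i
    (F := fun H => (ENNReal.ofReal (‖residual r H i‖ ^ 2))⁻¹)
    ((measurable_residual r i).norm.pow_const 2).ennreal_ofReal.inv]
  have h : ∀ H : Matrix (Fin m) (Fin k) ℝ,
      ∫⁻ y, (ENNReal.ofReal (‖residual r (H.updateRow i y) i‖ ^ 2))⁻¹
        ∂(Measure.pi fun _ : Fin k => gaussianReal 0 1) ≤ ENNReal.ofReal (1 / ((p : ℝ) - 1)) := by
    intro H
    simp only [residual, rowVec_update_self, otherRows_update_self]
    have := finrank_span_otherRows_lt H hi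
    exact lintegral_inv_dist_sq_le hp _ (by omega)
  refine (lintegral_mono h).trans ?_
  simp

theorem ae_residual_ne_zero {m k r p : ℕ} (hp : 2 ≤ p) (hk : r + p ≤ k) {i : Fin m}
    (hi : (i : ℕ) < r) : ∀ᵐ H ∂(gaussianMatrix m k 1), residual r H i ≠ 0 := by
  have h := ae_lt_top (((measurable_residual (m := m) (k := k) r i).norm.pow_const
    2).ennreal_ofReal.inv) ((lintegral_inv_residual_le hp hk hi).trans_lt ENNReal.ofReal_lt_top).ne
  filter_upwards [h] with H hH h0
  simp [h0] at hH

/-- A row outside the first `r` is independent of the dual basis of the first `r` rows. -/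
theorem lintegral_inner_dualVec_rowVec_le {m k r p : ℕ} (hp : 2 ≤ p) (hk : r + p ≤ k)
    {i j : Fin m} (hi : (i : ℕ) < r) (hj : r ≤ (j : ℕ)) :
    ∫⁻ H, ENNReal.ofReal (inner ℝ (dualVec r H i) (rowVec H j) ^ 2) ∂(gaussianMatrix m k 1) ≤
      ENNReal.ofReal (1 / ((p : ℝ) - 1)) := by
  rw [lintegral_gaussianMatrix_update j
    (((measurable_dualVec r i).inner (measurable_rowVec j)).pow_const 2).ennreal_ofReal]
  refine (lintegral_mono fun H => ?_).trans (lintegral_inv_residual_le hp hk hi)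
  simp only [dualVec, rowVec_update_self, residual_update_of_le H hi hj]
  rw [lintegral_inner_sq]
  by_cases h0 : residual r H i = 0
  · simp [h0]
  · have hpos : 0 < ‖residual r H i‖ := norm_pos_iff.2 h0
    rw [← ENNReal.ofReal_inv_of_pos (by positivity)]
    refine ENNReal.ofReal_le_ofReal (le_of_eq ?_)
    rw [norm_smul, norm_inv, norm_pow, norm_norm]
    field_simp

/-! ### The expected error of the range finder -/

/-- The deterministic part of the error bound. Write `M = U D` and let `X` have the dual vectors of
the first `r` rows of `H` as its first `r` columns and zeros elsewhere. Then the first `r` rows of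
`1 - H X` vanish, so `M - (M H) X = U D (1 - H X)` involves only the trailing entries of `D`. -/
theorem error_sq_le {m n k r : ℕ} (A : Matrix (Fin m) (Fin n) ℝ) (ρ : ℝ)
    {U : Matrix (Fin m) (Fin m) ℝ} {d : Fin m → ℝ} (hU : Uᵀ * U = 1)
    (hM : (U * Matrix.diagonal d) * (U * Matrix.diagonal d)ᵀ =
      A * Aᵀ + ρ ^ 2 • (1 : Matrix (Fin m) (Fin m) ℝ))
    {H : Matrix (Fin m) (Fin k) ℝ} (hH : ∀ i : Fin m, (i : ℕ) < r → residual r H i ≠ 0) :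
    error A (orthonormalizeColumns (U * Matrix.diagonal d * H)) ^ 2 ≤
      ∑ j ∈ {j : Fin m | r ≤ (j : ℕ)}, d j ^ 2 *
        (1 + ∑ i ∈ {i : Fin m | (i : ℕ) < r}, inner ℝ (dualVec r H i) (rowVec H j) ^ 2) := by
  let X : Matrix (Fin k) (Fin m) ℝ := Matrix.of fun c i =>
    if (i : ℕ) < r then dualVec r H i c else 0
  have h1 := error_le_of_covariance A ρ _ hM (U * Matrix.diagonal d * H) X
  have h2 : U * Matrix.diagonal d - U * Matrix.diagonal d * H * X =
      U * (Matrix.diagonal d * (1 - H * X)) := by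
    simp only [Matrix.mul_sub, Matrix.mul_assoc, Matrix.mul_one]
  rw [h2] at h1
  have h3 := pow_le_pow_left₀ (norm_nonneg _) h1 2
  rw [frobenius_orthogonal_mul hU, frobenius_sq (Matrix.diagonal d * (1 - H * X))] at h3
  refine h3.trans (le_of_eq ?_)
  have hHX : ∀ j i, (H * X) j i =
      if (i : ℕ) < r then inner ℝ (dualVec r H i) (rowVec H j) else 0 := by
    intro j i
    split_ifs with h
    · simp [X, Matrix.mul_apply, h, rowVec, PiLp.inner_apply]
    · simp [X, Matrix.mul_apply, h]
  rw [Finset.sum_filter]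
  refine Finset.sum_congr rfl fun j _ => ?_
  simp_rw [Matrix.diagonal_mul, Matrix.sub_apply, hHX, Matrix.one_apply, mul_pow]
  rw [← Finset.mul_sum]
  split_ifs with hj
  · congr 1
    have h4 : ∀ i : Fin m, ((if j = i then (1 : ℝ) else 0) -
        (if (i : ℕ) < r then inner ℝ (dualVec r H i) (rowVec H j) else 0)) ^ 2 =
        (if j = i then (1 : ℝ) else 0) +
        (if (i : ℕ) < r then inner ℝ (dualVec r H i) (rowVec H j) ^ 2 else 0) := by
      intro i
      by_cases hji : j = i
      · subst hji
        simp [not_lt.2 hj]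
      · by_cases hi : (i : ℕ) < r <;> simp [hji, hi]
    simp_rw [h4]
    rw [Finset.sum_add_distrib, Finset.sum_filter]
    simp
  · rw [Finset.sum_eq_zero, mul_zero]
    intro i _
    by_cases hi : (i : ℕ) < r
    · rw [if_pos hi, inner_dualVec_rowVec (hH i hi) (not_le.1 hj)]
      simp
    · have : j ≠ i := fun h => by subst h; omega
      simp [this, hi]

/-- The bound for the mean square error, before the passage to `(σⱼ + ρ)²`. -/
theorem lintegral_error_sq_le {m n k r p : ℕ} (hp : 2 ≤ p) (hk : r + p ≤ k) (hrm : r ≤ m)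
    (A : Matrix (Fin m) (Fin n) ℝ) (ρ : ℝ) :
    ∫⁻ θ, ENNReal.ofReal (error A (output A θ) ^ 2) ∂(seed m n k ρ) ≤
      ENNReal.ofReal ((1 + (r : ℝ) / ((p : ℝ) - 1)) *
        ∑ j ∈ Finset.Ico r m, (singularValue A j ^ 2 + ρ ^ 2)) := by
  have hp1 : (0 : ℝ) < (p : ℝ) - 1 := by
    have : (2 : ℝ) ≤ p := by exact_mod_cast hp
    linarith
  obtain ⟨U, hU, hM⟩ := exists_sqrt_covariance A ρ
  set d : Fin m → ℝ := fun j => √(singularValue A j ^ 2 + ρ ^ 2) with hd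
  have hF : Measurable fun Y : Matrix (Fin m) (Fin k) ℝ =>
      ENNReal.ofReal (error A (orthonormalizeColumns Y) ^ 2) :=
    ((measurable_error A).pow_const 2).ennreal_ofReal
  have h1 : ∫⁻ θ, ENNReal.ofReal (error A (output A θ) ^ 2) ∂(seed m n k ρ) =
      ∫⁻ H, ENNReal.ofReal (error A (orthonormalizeColumns (U * Matrix.diagonal d * H)) ^ 2)
        ∂(gaussianMatrix m k 1) := by
    have h2 := lintegral_map (μ := seed m n k ρ) hF (measurable_sketch A)
    have h3 := lintegral_map (μ := gaussianMatrix m k 1) hF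
      (measurable_matrix_mul (measurable_const (a := U * Matrix.diagonal d)) measurable_id)
    have h4 := map_sketch_seed_eq (k := k) A ρ _ hM
    simp only [id] at h3
    rw [← h3, ← h4, h2]
    rfl
  -- the sketch may now be replaced by `U D H` with a standard Gaussian matrix `H`
  rw [h1]
  have hmeas : ∀ i j : Fin m, Measurable fun H : Matrix (Fin m) (Fin k) ℝ =>
      ENNReal.ofReal (inner ℝ (dualVec r H i) (rowVec H j) ^ 2) := fun i j =>
    (((measurable_dualVec r i).inner (measurable_rowVec j)).pow_const 2).ennreal_ofReal
  have hae : ∀ᵐ H ∂(gaussianMatrix m k 1), ∀ i : Fin m, (i : ℕ) < r → residual r H i ≠ 0 :=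
    ae_all_iff.2 fun i => by
      by_cases hi : (i : ℕ) < r
      · filter_upwards [ae_residual_ne_zero hp hk hi] with H hH _ using hH
      · exact Filter.Eventually.of_forall fun H h => (hi h).elim
  have hle : ∀ᵐ H ∂(gaussianMatrix m k 1),
      ENNReal.ofReal (error A (orthonormalizeColumns (U * Matrix.diagonal d * H)) ^ 2) ≤
      ∑ j ∈ {j : Fin m | r ≤ (j : ℕ)}, ENNReal.ofReal (d j ^ 2) *
        (1 + ∑ i ∈ {i : Fin m | (i : ℕ) < r},
          ENNReal.ofReal (inner ℝ (dualVec r H i) (rowVec H j) ^ 2)) := by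
    filter_upwards [hae] with H hH
    refine (ENNReal.ofReal_le_ofReal (error_sq_le A ρ hU hM hH)).trans (le_of_eq ?_)
    rw [ENNReal.ofReal_sum_of_nonneg (fun j _ => by positivity)]
    refine Finset.sum_congr rfl fun j _ => ?_
    rw [ENNReal.ofReal_mul (by positivity), ENNReal.ofReal_add zero_le_one (by positivity),
      ENNReal.ofReal_one, ENNReal.ofReal_sum_of_nonneg (fun i _ => by positivity)]
  refine (lintegral_mono_ae hle).trans ?_
  rw [lintegral_finsetSum' _ fun j _ => Measurable.aemeasurable
    (((Finset.measurable_sum _ fun i _ => hmeas i j).const_add 1).const_mul _)]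
  have hsum : ∀ j : Fin m, r ≤ (j : ℕ) →
      ∫⁻ H, ENNReal.ofReal (d j ^ 2) * (1 + ∑ i ∈ {i : Fin m | (i : ℕ) < r},
          ENNReal.ofReal (inner ℝ (dualVec r H i) (rowVec H j) ^ 2)) ∂(gaussianMatrix m k 1) ≤
      ENNReal.ofReal ((1 + (r : ℝ) / ((p : ℝ) - 1)) * (singularValue A j ^ 2 + ρ ^ 2)) := by
    intro j hj
    rw [lintegral_const_mul _ ((Finset.measurable_sum _ fun i _ => hmeas i j).const_add 1),
      lintegral_add_left measurable_const, lintegral_finsetSum _ fun i _ => hmeas i j]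
    have hcard : (Finset.univ.filter fun i : Fin m => (i : ℕ) < r).card = r := by
      rw [Fin.card_filter_val_lt, min_eq_right hrm]
    have h5 : ∑ i ∈ {i : Fin m | (i : ℕ) < r},
        ∫⁻ H, ENNReal.ofReal (inner ℝ (dualVec r H i) (rowVec H j) ^ 2) ∂(gaussianMatrix m k 1) ≤
        ENNReal.ofReal ((r : ℝ) / ((p : ℝ) - 1)) := by
      refine (Finset.sum_le_sum fun i hi => lintegral_inner_dualVec_rowVec_le hp hk
        (Finset.mem_filter.1 hi).2 hj).trans (le_of_eq ?_)
      rw [Finset.sum_const, hcard, nsmul_eq_mul, ← ENNReal.ofReal_natCast,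
        ← ENNReal.ofReal_mul (by positivity)]
      congr 1
      ring
    have h6 : d j ^ 2 = singularValue A j ^ 2 + ρ ^ 2 := Real.sq_sqrt (by positivity)
    rw [h6, mul_comm (1 + (r : ℝ) / ((p : ℝ) - 1)), ENNReal.ofReal_mul (by positivity),
      ENNReal.ofReal_add zero_le_one (by positivity), ENNReal.ofReal_one]
    gcongr
    simp
  refine (Finset.sum_le_sum fun j hj => hsum j (Finset.mem_filter.1 hj).2).trans (le_of_eq ?_)
  rw [← ENNReal.ofReal_sum_of_nonneg (fun j _ => by positivity), ← Finset.mul_sum]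
  congr 2
  have hIco : Finset.Ico r m = (Finset.range m).filter (r ≤ ·) := by
    ext j
    simp [and_comm]
  rw [hIco, Finset.sum_filter, Finset.sum_filter, Finset.sum_range]

theorem memLp_error {m n k : ℕ} (A : Matrix (Fin m) (Fin n) ℝ) (ρ : ℝ) :
    MemLp (fun θ => error A (output A θ)) 2 (seed m n k ρ) := by
  refine MemLp.of_bound ((measurable_error A).comp (measurable_sketch A)).aestronglyMeasurable ‖A‖
    (Filter.Eventually.of_forall fun θ => ?_)
  rw [error, norm_norm]
  exact norm_sub_projection_le _ A

/-- The bound for the expected error; the variance being nonnegative, it follows from the bound for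
the mean square. -/
theorem integral_error_le {m n k r p : ℕ} (hp : 2 ≤ p) (hk : r + p ≤ k) (hrm : r ≤ m)
    (A : Matrix (Fin m) (Fin n) ℝ) {ρ : ℝ} (hρ : 0 ≤ ρ) :
    ∫ θ, error A (output A θ) ∂(seed m n k ρ) ≤
      √(1 + (r : ℝ) / ((p : ℝ) - 1)) *
        √(∑ j ∈ Finset.Ico r m, (singularValue A j + ρ) ^ 2) := by
  have hp1 : (0 : ℝ) < (p : ℝ) - 1 := by
    have : (2 : ℝ) ≤ p := by exact_mod_cast hp
    linarith
  have hL := memLp_error (k := k) A ρ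
  have h1 := lintegral_error_sq_le hp hk hrm A ρ
  rw [← ofReal_integral_eq_lintegral_ofReal hL.integrable_sq
    (Filter.Eventually.of_forall fun θ => sq_nonneg _),
    ENNReal.ofReal_le_ofReal_iff (by positivity)] at h1
  have h2 := variance_nonneg (fun θ => error A (output A θ)) (seed m n k ρ)
  rw [variance_eq_sub hL] at h2
  rw [← Real.sqrt_mul (by positivity)]
  refine Real.le_sqrt_of_sq_le ?_
  calc _ ≤ _ := sub_nonneg.1 h2
    _ ≤ _ := h1
    _ ≤ _ := by
      gcongr with j hj
      have := mul_nonneg (singularValue_nonneg A j) hρ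
      nlinarith

/-- The error bound with probability `99 / 100`. For `p ≥ r + 1` the expected error is at most twice
the bracket, so that Markov's inequality gives the constant `200`. -/
theorem measure_error_le {m n r p : ℕ} (hrp : r + 1 ≤ p) (hk : r + p ≤ min m n)
    (A : Matrix (Fin m) (Fin n) ℝ) {ρ : ℝ} (hρ : 0 ≤ ρ) :
    ENNReal.ofReal (99 / 100) ≤ (seed m n (r + p) ρ) {θ | error A (output A θ) ≤
      200 * (√(∑ j ∈ Finset.Ico r m, singularValue A j ^ 2) + ρ * √m)} := by
  set B := √(∑ j ∈ Finset.Ico r m, singularValue A j ^ 2) + ρ * √m with hB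
  have hB0 : 0 ≤ B := by positivity
  rcases Nat.eq_zero_or_pos r with hr | hr
  · -- for `r = 0` the bound holds surely, since the residual is a projection of `A`
    have huniv : {θ : Matrix (Fin n) (Fin (r + p)) ℝ × Matrix (Fin m) (Fin (r + p)) ℝ |
        error A (output A θ) ≤ 200 * B} = Set.univ := by
      refine Set.eq_univ_of_forall fun θ => ?_
      have h1 : error A (output A θ) ≤ ‖A‖ := norm_sub_projection_le _ A
      have h2 : ‖A‖ = √(∑ j ∈ Finset.Ico r m, singularValue A j ^ 2) := by
        rw [hr, ← Finset.range_eq_Ico, ← frobenius_sq_eq_sum_singularValue,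
          Real.sqrt_sq (norm_nonneg _)]
      have h3 : 0 ≤ ρ * √m := by positivity
      simp only [Set.mem_ofPred_eq]
      linarith
    rw [huniv, measure_univ, ← ENNReal.ofReal_one]
    exact ENNReal.ofReal_le_ofReal (by norm_num)
  · have hp : 2 ≤ p := by omega
    have hrm : r ≤ m := by omega
    have hL := memLp_error (k := r + p) A ρ
    have hp1 : (0 : ℝ) < (p : ℝ) - 1 := by
      have : (2 : ℝ) ≤ p := by exact_mod_cast hp
      linarith
    have hE : ∫ θ, error A (output A θ) ∂(seed m n (r + p) ρ) ≤ 2 * B := by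
      refine (integral_error_le hp le_rfl hrm A hρ).trans ?_
      have h1 : 1 + (r : ℝ) / ((p : ℝ) - 1) ≤ 2 := by
        have h2 : (r : ℝ) + 1 ≤ p := by exact_mod_cast hrp
        have h3 : (r : ℝ) / ((p : ℝ) - 1) ≤ 1 := by
          rw [div_le_one hp1]
          linarith
        linarith
      have h2 : ∑ j ∈ Finset.Ico r m, (singularValue A j + ρ) ^ 2 ≤
          2 * (∑ j ∈ Finset.Ico r m, singularValue A j ^ 2 + ρ ^ 2 * m) := by
        have h3 : ∑ j ∈ Finset.Ico r m, (singularValue A j + ρ) ^ 2 ≤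
            ∑ j ∈ Finset.Ico r m, 2 * (singularValue A j ^ 2 + ρ ^ 2) :=
          Finset.sum_le_sum fun j _ => by nlinarith [sq_nonneg (singularValue A j - ρ)]
        rw [← Finset.mul_sum, Finset.sum_add_distrib, Finset.sum_const, Nat.card_Ico,
          nsmul_eq_mul] at h3
        have h4 : ((m - r : ℕ) : ℝ) * ρ ^ 2 ≤ ρ ^ 2 * m := by
          rw [mul_comm]
          gcongr
          omega
        linarith
      calc _ ≤ √2 * √(2 * (∑ j ∈ Finset.Ico r m, singularValue A j ^ 2 + ρ ^ 2 * m)) := by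
            gcongr
        _ = 2 * √(∑ j ∈ Finset.Ico r m, singularValue A j ^ 2 + ρ ^ 2 * m) := by
            rw [Real.sqrt_mul (by norm_num), ← mul_assoc, Real.mul_self_sqrt (by norm_num)]
        _ ≤ 2 * B := by
            gcongr
            have h5 : 0 ≤ ∑ j ∈ Finset.Ico r m, singularValue A j ^ 2 := by positivity
            refine Real.sqrt_le_iff.2 ⟨hB0, ?_⟩
            rw [hB, add_sq, Real.sq_sqrt h5, mul_pow, Real.sq_sqrt (Nat.cast_nonneg m)]
            have : 0 ≤ 2 * √(∑ j ∈ Finset.Ico r m, singularValue A j ^ 2) * (ρ * √m) := by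
              positivity
            linarith
    -- Markov's inequality; if the bracket vanishes, the error is zero almost surely
    have hcompl : (seed m n (r + p) ρ).real {θ | 200 * B < error A (output A θ)} ≤ 1 / 100 := by
      rcases hB0.eq_or_lt with h0 | hpos
      · have hz : (fun θ => error A (output A θ)) =ᵐ[seed m n (r + p) ρ] 0 := by
          refine (integral_eq_zero_iff_of_nonneg (fun θ => norm_nonneg _)
            (hL.integrable one_le_two)).1 ?_
          exact le_antisymm (hE.trans (by linarith)) (integral_nonneg fun θ => norm_nonneg _)
        have : (seed m n (r + p) ρ) {θ | 200 * B < error A (output A θ)} = 0 := by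
          rw [← h0]
          refine measure_mono_null (fun θ hθ => ?_) (ae_iff.1 hz)
          have h4 : 200 * 0 < error A (output A θ) := hθ
          rw [mul_zero] at h4
          exact h4.ne'
        rw [Measure.real, this]
        norm_num
      · have h3 := mul_meas_ge_le_integral_of_nonneg
          (Filter.Eventually.of_forall fun θ => norm_nonneg _)
          (hL.integrable one_le_two) (200 * B)
        have h4 : (seed m n (r + p) ρ).real {θ | 200 * B < error A (output A θ)} ≤
            (seed m n (r + p) ρ).real {θ | 200 * B ≤ error A (output A θ)} :=
          measureReal_mono (Set.ofPred_subset_ofPred.2 fun θ hθ => le_of_lt hθ)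
        have h5 : 200 * B * (seed m n (r + p) ρ).real {θ | 200 * B ≤ error A (output A θ)} ≤
          2 * B := h3.trans hE
        have h6 : (seed m n (r + p) ρ).real {θ | 200 * B ≤ error A (output A θ)} ≤ 1 / 100 := by
          by_contra hcon
          nlinarith
        linarith
    have hmeas : MeasurableSet {θ : Matrix (Fin n) (Fin (r + p)) ℝ ×
        Matrix (Fin m) (Fin (r + p)) ℝ | error A (output A θ) ≤ 200 * B} :=
      measurableSet_le ((measurable_error A).comp (measurable_sketch A)) measurable_const
    have h7 := probReal_compl_eq_one_sub (μ := seed m n (r + p) ρ) hmeas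
    have h8 : {θ : Matrix (Fin n) (Fin (r + p)) ℝ × Matrix (Fin m) (Fin (r + p)) ℝ |
        error A (output A θ) ≤ 200 * B}ᶜ = {θ | 200 * B < error A (output A θ)} := by
      ext θ
      simp
    rw [h8] at h7
    refine (ENNReal.ofReal_le_iff_le_toReal (measure_ne_top _ _)).2 ?_
    change _ ≤ (seed m n (r + p) ρ).real _
    linarith

/-! ### The Gaussian mechanism -/

theorem gaussianReal_eq_withDensity (a : ℝ) {v : NNReal} (hv : v ≠ 0) :
    gaussianReal a v = (gaussianReal 0 v).withDensity
      fun y => ENNReal.ofReal (Real.exp ((a * y - a ^ 2 / 2) / v)) := by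
  have hv' : (v : ℝ) ≠ 0 := NNReal.coe_ne_zero.2 hv
  rw [gaussianReal_of_var_ne_zero _ hv, gaussianReal_of_var_ne_zero _ hv,
    ← withDensity_mul _ (measurable_gaussianPDF _ _) (by fun_prop)]
  congr 1
  funext y
  simp only [Pi.mul_apply, gaussianPDF]
  rw [← ENNReal.ofReal_mul (gaussianPDFReal_nonneg _ _ _)]
  congr 1
  simp only [gaussianPDFReal]
  rw [mul_assoc (√_)⁻¹, ← Real.exp_add]
  congr 2
  field_simp
  ring

/-- The density of a shifted Gaussian vector with respect to the centred one. -/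
theorem pi_gaussianReal_eq_withDensity {k : ℕ} (a : Fin k → ℝ) {v : NNReal} (hv : v ≠ 0) :
    (Measure.pi fun i => gaussianReal (a i) v) =
      (Measure.pi fun _ : Fin k => gaussianReal 0 v).withDensity
        fun y => ∏ i, ENNReal.ofReal (Real.exp ((a i * y i - a i ^ 2 / 2) / v)) := by
  refine Measure.pi_eq fun s hs => ?_
  rw [withDensity_apply _ (MeasurableSet.univ_pi hs),
    ← lintegral_indicator (MeasurableSet.univ_pi hs)]
  have h1 : ∀ y : Fin k → ℝ, (Set.univ.pi s).indicator
      (fun y => ∏ i, ENNReal.ofReal (Real.exp ((a i * y i - a i ^ 2 / 2) / v))) y =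
      ∏ i, (s i).indicator
        (fun t => ENNReal.ofReal (Real.exp ((a i * t - a i ^ 2 / 2) / v))) (y i) := by
    intro y
    by_cases hy : y ∈ Set.univ.pi s
    · rw [Set.indicator_of_mem hy]
      exact Finset.prod_congr rfl fun i _ => by
        rw [Set.indicator_of_mem (hy i (Set.mem_univ i))]
    · rw [Set.indicator_of_notMem hy]
      have : ∃ i, y i ∉ s i := by simpa [Set.mem_pi] using hy
      obtain ⟨i, hi⟩ := this
      exact (Finset.prod_eq_zero (Finset.mem_univ i) (Set.indicator_of_notMem hi _)).symm
  have hm : ∀ i, Measurable ((s i).indicator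
      (fun t : ℝ => ENNReal.ofReal (Real.exp ((a i * t - a i ^ 2 / 2) / v)))) := fun i =>
    Measurable.indicator (by fun_prop) (hs i)
  simp_rw [h1]
  rw [lintegral_prod_eq_prod_lintegral_of_indepFun Finset.univ
    (fun i (y : Fin k → ℝ) => (s i).indicator
      (fun t : ℝ => ENNReal.ofReal (Real.exp ((a i * t - a i ^ 2 / 2) / v))) (y i))
    (iIndepFun_pi (fun i => (hm i).aemeasurable)) (fun i => (hm i).comp (measurable_pi_apply i))]
  refine Finset.prod_congr rfl fun i _ => ?_
  rw [gaussianReal_eq_withDensity (a i) hv, withDensity_apply _ (hs i),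
    ← lintegral_indicator (hs i)]
  exact (measurePreserving_eval (fun _ : Fin k => gaussianReal 0 v) i).lintegral_comp (hm i)

/-- The Chernoff bound in a form that needs only an upper bound for the variance, which may be `0`:
the variance is at most `t² / (2 L)`, and this variance proxy gives the bound `exp (-L)`. -/
theorem gaussianReal_tail_le {w : NNReal} {t L : ℝ} (ht : 0 < t) (hL : 0 < L)
    (hw : 2 * L * w ≤ t ^ 2) :
    (gaussianReal 0 w) (Set.Ici t) ≤ ENNReal.ofReal (Real.exp (-L)) := by
  have hc0 : 0 < t ^ 2 / (2 * L) := by positivity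
  set c : NNReal := ⟨t ^ 2 / (2 * L), hc0.le⟩ with hc
  have hwc : (w : ℝ) ≤ c := by
    change (w : ℝ) ≤ t ^ 2 / (2 * L)
    rw [le_div_iff₀ (by positivity)]
    linarith
  have hsub : HasSubgaussianMGF id c (gaussianReal 0 w) := by
    refine ⟨fun s => integrable_exp_mul_gaussianReal s, fun s => ?_⟩
    rw [mgf_id_gaussianReal]
    refine Real.exp_le_exp.2 ?_
    rw [zero_mul, zero_add]
    gcongr
  have h := hsub.measure_ge_le ht.le
  rw [← ofReal_measureReal]
  refine ENNReal.ofReal_le_ofReal (h.trans (le_of_eq ?_))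
  congr 1
  change -t ^ 2 / (2 * (t ^ 2 / (2 * L))) = -L
  field_simp

theorem map_inner_pi_gaussianReal_sq {k : ℕ} (a : EuclideanSpace ℝ (Fin k)) (ρ : ℝ) :
    (Measure.pi fun _ : Fin k => gaussianReal 0 (Real.toNNReal (ρ ^ 2))).map
      (fun x => inner ℝ a (WithLp.toLp 2 x)) =
      gaussianReal 0 (Real.toNNReal (ρ ^ 2 * ‖a‖ ^ 2)) := by
  have h1 : gaussianReal 0 (Real.toNNReal (ρ ^ 2)) = (gaussianReal 0 1).map (ρ * ·) := by
    rw [gaussianReal_map_const_mul]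
    congr 1
    · simp
    · ext
      simp [sq_nonneg]
  have h2 : (Measure.pi fun _ : Fin k => gaussianReal 0 (Real.toNNReal (ρ ^ 2))) =
      (Measure.pi fun _ : Fin k => gaussianReal 0 1).map (fun x i => ρ * x i) := by
    have : ∀ i : Fin k, IsProbabilityMeasure ((gaussianReal 0 1).map (ρ * ·)) := fun _ =>
      Measure.isProbabilityMeasure_map (by fun_prop)
    rw [Measure.pi_map_pi (fun i => by fun_prop), h1]
  have h3 : (fun x : Fin k → ℝ => inner ℝ a (WithLp.toLp 2 x)) ∘ (fun x i => ρ * x i) =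
      fun x => inner ℝ (ρ • a) (WithLp.toLp 2 x) := by
    funext x
    simp only [Function.comp, PiLp.inner_apply, PiLp.smul_apply, smul_eq_mul]
    refine Finset.sum_congr rfl fun i _ => ?_
    simp
    ring
  rw [h2, Measure.map_map (by fun_prop) (by fun_prop), h3, map_inner_pi_eq_gaussianReal, norm_smul,
    mul_pow, Real.norm_eq_abs, sq_abs]

/-- The Gaussian mechanism with noise scale `ρ` for a shift `a`: apart from an event of probability
`exp (-L)`, the logarithm of the density ratio is at most `ε`. -/
theorem gaussian_mechanism {k : ℕ} (a : EuclideanSpace ℝ (Fin k)) {ρ ε L : ℝ} (hρ : 0 < ρ)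
    (hε : 0 < ε) (hε1 : ε < 1) (hL : 1 ≤ L) (ha : 4 * L * ‖a‖ ^ 2 ≤ ρ ^ 2 * ε ^ 2)
    {T : Set (Fin k → ℝ)} (hT : MeasurableSet T) :
    (Measure.pi fun _ : Fin k => gaussianReal 0 (Real.toNNReal (ρ ^ 2))) {y | ⇑a + y ∈ T} ≤
      ENNReal.ofReal (Real.exp ε) *
        (Measure.pi fun _ : Fin k => gaussianReal 0 (Real.toNNReal (ρ ^ 2))) T +
      ENNReal.ofReal (Real.exp (-L)) := by
  set v := Real.toNNReal (ρ ^ 2) with hv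
  have hvc : (v : ℝ) = ρ ^ 2 := Real.coe_toNNReal _ (sq_nonneg ρ)
  have hv0 : v ≠ 0 := by
    rw [← NNReal.coe_ne_zero, hvc]
    positivity
  set ν := Measure.pi fun _ : Fin k => gaussianReal 0 v with hν
  have hmap : ν.map (fun y => ⇑a + y) = Measure.pi fun i => gaussianReal (a i) v := by
    have h1 : ∀ i : Fin k, (gaussianReal 0 v).map (a i + ·) = gaussianReal (a i) v := by
      intro i
      rw [gaussianReal_map_const_add, zero_add]
    have : ∀ i : Fin k, IsProbabilityMeasure ((gaussianReal 0 v).map (a i + ·)) := fun _ =>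
      Measure.isProbabilityMeasure_map (by fun_prop)
    have h2 := Measure.pi_map_pi (μ := fun _ : Fin k => gaussianReal 0 v)
      (f := fun i t => a i + t) (fun i => by fun_prop)
    simp_rw [h1] at h2
    exact h2
  have hadd : Measurable fun y : Fin k → ℝ => ⇑a + y := measurable_const.add measurable_id
  -- the logarithm of the density of the shifted vector
  let ℓ : (Fin k → ℝ) → ℝ := fun y => (inner ℝ a (WithLp.toLp 2 y) - ‖a‖ ^ 2 / 2) / v
  have hℓ : Measurable ℓ := by
    have : Measurable fun y : Fin k → ℝ => inner ℝ a (WithLp.toLp 2 y) := by fun_prop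
    exact (this.sub_const _).div_const _
  have hdens : ν.map (fun y => ⇑a + y) = ν.withDensity fun y => ENNReal.ofReal (Real.exp (ℓ y)) := by
    rw [hmap, pi_gaussianReal_eq_withDensity _ hv0]
    congr 1
    funext y
    rw [← ENNReal.ofReal_prod_of_nonneg (fun i _ => (Real.exp_pos _).le), ← Real.exp_sum]
    congr 2
    simp only [ℓ]
    rw [← Finset.sum_div, Finset.sum_sub_distrib, ← Finset.sum_div]
    congr 2
    · simp [PiLp.inner_apply, mul_comm]
    · rw [EuclideanSpace.norm_sq_eq]
      simp
  have hsplit : ν.map (fun y => ⇑a + y) T ≤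
      ν.map (fun y => ⇑a + y) (T ∩ {y | ℓ y ≤ ε}) + ν.map (fun y => ⇑a + y) {y | ε < ℓ y} := by
    refine (measure_mono fun y hy => ?_).trans (measure_union_le _ _)
    by_cases h : ℓ y ≤ ε
    · exact Or.inl ⟨hy, h⟩
    · exact Or.inr (not_le.1 h)
  have hgood : ν.map (fun y => ⇑a + y) (T ∩ {y | ℓ y ≤ ε}) ≤ ENNReal.ofReal (Real.exp ε) * ν T := by
    have hTm : MeasurableSet (T ∩ {y | ℓ y ≤ ε}) := hT.inter (measurableSet_le hℓ measurable_const)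
    rw [hdens, withDensity_apply _ hTm]
    calc _ ≤ ∫⁻ _ in T ∩ {y | ℓ y ≤ ε}, ENNReal.ofReal (Real.exp ε) ∂ν :=
          setLIntegral_mono' hTm fun y hy =>
            ENNReal.ofReal_le_ofReal (Real.exp_le_exp.2 hy.2)
      _ = ENNReal.ofReal (Real.exp ε) * ν (T ∩ {y | ℓ y ≤ ε}) := by
          rw [setLIntegral_const]
      _ ≤ _ := by
          gcongr
          exact Set.inter_subset_left
  have hbad : ν.map (fun y => ⇑a + y) {y | ε < ℓ y} ≤ ENNReal.ofReal (Real.exp (-L)) := by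
    rw [Measure.map_apply hadd (measurableSet_lt measurable_const hℓ)]
    set t := ρ ^ 2 * ε - ‖a‖ ^ 2 / 2 with ht
    have hρ2 : 0 < ρ ^ 2 := by positivity
    have hs : ‖a‖ ^ 2 ≤ ρ ^ 2 * ε := by
      have h1 : ρ ^ 2 * ε ^ 2 ≤ ρ ^ 2 * ε := by
        gcongr
        nlinarith
      nlinarith [sq_nonneg ‖a‖]
    have ht0 : 0 < t := by nlinarith
    -- in the law of the shifted vector, `ε < ℓ` says that a centred Gaussian variable of variance
    -- `ρ² ‖a‖²` exceeds `t`
    have htail := gaussianReal_tail_le (w := Real.toNNReal (ρ ^ 2 * ‖a‖ ^ 2)) ht0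
      (by linarith : 0 < L) (by
        rw [Real.coe_toNNReal _ (by positivity)]
        have h1 : t ^ 2 = ρ ^ 2 * (ρ ^ 2 * ε ^ 2) - ρ ^ 2 * ‖a‖ ^ 2 * ε + (‖a‖ ^ 2) ^ 2 / 4 := by
          rw [ht]
          ring
        have h2 : ρ ^ 2 * (4 * L * ‖a‖ ^ 2) ≤ ρ ^ 2 * (ρ ^ 2 * ε ^ 2) := by gcongr
        have h3 : ρ ^ 2 * ‖a‖ ^ 2 * ε ≤ ρ ^ 2 * ‖a‖ ^ 2 * L := by
          gcongr
          linarith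
        have h4 : 0 ≤ ρ ^ 2 * ‖a‖ ^ 2 * L := by positivity
        nlinarith [sq_nonneg (‖a‖ ^ 2)])
    rw [← map_inner_pi_gaussianReal_sq, Measure.map_apply (by fun_prop) measurableSet_Ici] at htail
    refine (measure_mono fun y hy => ?_).trans htail
    have hy' : ε < (inner ℝ a (WithLp.toLp 2 (⇑a + y)) - ‖a‖ ^ 2 / 2) / v := hy
    have h5 : inner ℝ a (WithLp.toLp 2 (⇑a + y)) = ‖a‖ ^ 2 + inner ℝ a (WithLp.toLp 2 y) := by
      rw [WithLp.toLp_add, inner_add_right, WithLp.toLp_ofLp, real_inner_self_eq_norm_sq]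
    rw [h5, hvc, lt_div_iff₀ hρ2] at hy'
    change t ≤ inner ℝ a (WithLp.toLp 2 y)
    linarith
  have hfin := hsplit.trans (add_le_add hgood hbad)
  rw [Measure.map_apply hadd hT] at hfin
  exact hfin

/-- The Gaussian mechanism for matrices whose noiseless values differ in a single row. -/
theorem gaussian_mechanism_matrix {m k : ℕ} {B B' : Matrix (Fin m) (Fin k) ℝ} {i : Fin m}
    (hB : ∀ j, j ≠ i → B j = B' j) {ρ ε L : ℝ} (hρ : 0 < ρ)
    (hε : 0 < ε) (hε1 : ε < 1) (hL : 1 ≤ L)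
    (ha : 4 * L * ‖rowVec (B - B') i‖ ^ 2 ≤ ρ ^ 2 * ε ^ 2)
    {T : Set (Matrix (Fin m) (Fin k) ℝ)} (hT : MeasurableSet T) :
    gaussianMatrix m k ρ {N | B + N ∈ T} ≤
      ENNReal.ofReal (Real.exp ε) * gaussianMatrix m k ρ {N | B' + N ∈ T} +
      ENNReal.ofReal (Real.exp (-L)) := by
  have hadd : ∀ B : Matrix (Fin m) (Fin k) ℝ, Measurable fun N => B + N := by
    intro B
    rw [measurable_matrix_iff]
    exact fun i j => (measurable_apply_apply i j).const_add _
  have hupd : ∀ (N : Matrix (Fin m) (Fin k) ℝ), Measurable fun y : Fin k → ℝ => N.updateRow i y :=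
    fun N => measurable_update (X := fun _ : Fin m => Fin k → ℝ) N
  -- integrate over the row `i` of the noise first
  have hint : ∀ B : Matrix (Fin m) (Fin k) ℝ, gaussianMatrix m k ρ {N | B + N ∈ T} =
      ∫⁻ N, (Measure.pi fun _ : Fin k => gaussianReal 0 (Real.toNNReal (ρ ^ 2)))
        {y | B + N.updateRow i y ∈ T} ∂(gaussianMatrix m k ρ) := by
    intro B
    have h1 : MeasurableSet {N | B + N ∈ T} := hadd B hT
    rw [← lintegral_indicator_one h1]
    have h2 := lintegral_pi_update (fun _ : Fin m => Measure.pi fun _ : Fin k =>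
      gaussianReal 0 (Real.toNNReal (ρ ^ 2))) i
      (F := fun N => ({N | B + N ∈ T} : Set (Matrix (Fin m) (Fin k) ℝ)).indicator 1 N)
      (measurable_one.indicator h1)
    exact h2.trans (lintegral_congr fun N =>
      lintegral_indicator_one ((hadd B).comp (hupd N) hT))
  have hle : ∀ N : Matrix (Fin m) (Fin k) ℝ,
      (Measure.pi fun _ : Fin k => gaussianReal 0 (Real.toNNReal (ρ ^ 2)))
        {y | B + N.updateRow i y ∈ T} ≤
      ENNReal.ofReal (Real.exp ε) *
        (Measure.pi fun _ : Fin k => gaussianReal 0 (Real.toNNReal (ρ ^ 2)))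
          {y | B' + N.updateRow i y ∈ T} + ENNReal.ofReal (Real.exp (-L)) := by
    intro N
    refine le_trans (le_of_eq ?_)
      (gaussian_mechanism (rowVec (B - B') i) hρ hε hε1 hL ha ((hadd B').comp (hupd N) hT))
    congr 1
    ext y
    have : B + N.updateRow i y = B' + N.updateRow i (⇑(rowVec (B - B') i) + y) := by
      ext j c
      by_cases hj : j = i
      · subst hj
        simp [rowVec]
        ring
      · have := congrFun (hB j hj) c
        simp [Matrix.updateRow_ne hj, this]
    change B + N.updateRow i y ∈ T ↔ B' + N.updateRow i (⇑(rowVec (B - B') i) + y) ∈ T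
    rw [this]
  rw [hint, hint B']
  refine (lintegral_mono hle).trans ?_
  rw [lintegral_add_right _ measurable_const, lintegral_const_mul', lintegral_const, measure_univ,
    mul_one]
  exact ENNReal.ofReal_ne_top

/-! ### Privacy of the range finder -/

theorem map_inner_column {n k : ℕ} (v : EuclideanSpace ℝ (Fin n)) (j : Fin k) :
    (gaussianMatrix n k 1).map (fun Z => inner ℝ v (colVec Z j)) =
      gaussianReal 0 (Real.toNNReal (‖v‖ ^ 2)) := by
  rw [← map_inner_pi_eq_gaussianReal]
  have h1 := measurePreserving_pi (fun _ : Fin n => Measure.pi fun _ : Fin k => gaussianReal 0 1)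
    (fun _ : Fin n => gaussianReal 0 1)
    (hf := fun _ => measurePreserving_eval (fun _ : Fin k => gaussianReal 0 1) j)
  rw [← h1.map_eq, Measure.map_map (by fun_prop) h1.measurable, gaussianMatrix_one]
  rfl

/-- The sensitivity `‖vᵀ Ω‖` is at most `√(2 k L)`, apart from an event of probability
`2 k exp (-L)`. -/
theorem measure_sensitivity_le {n k : ℕ} {v : EuclideanSpace ℝ (Fin n)} (hv : ‖v‖ ≤ 1) {L : ℝ}
    (hL : 0 < L) :
    (gaussianMatrix n k 1) {Z | 2 * k * L < ∑ j, inner ℝ v (colVec Z j) ^ 2} ≤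
      ENNReal.ofReal (2 * k * Real.exp (-L)) := by
  have htail : ∀ j : Fin k, ∀ u : EuclideanSpace ℝ (Fin n), ‖u‖ ≤ 1 →
      (gaussianMatrix n k 1) {Z | √(2 * L) ≤ inner ℝ u (colVec Z j)} ≤
        ENNReal.ofReal (Real.exp (-L)) := by
    intro j u hu
    have h1 := gaussianReal_tail_le (w := Real.toNNReal (‖u‖ ^ 2)) (t := √(2 * L)) (L := L)
      (by positivity) hL (by
        rw [Real.coe_toNNReal _ (sq_nonneg _), Real.sq_sqrt (by positivity)]
        have : ‖u‖ ^ 2 ≤ 1 := pow_le_one₀ (norm_nonneg _) hu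
        nlinarith)
    have hm : Measurable fun Z : Matrix (Fin n) (Fin k) ℝ => inner ℝ u (colVec Z j) :=
      measurable_const.inner (measurable_colVec j)
    rwa [← map_inner_column u j, Measure.map_apply hm measurableSet_Ici] at h1
  have hsub : {Z : Matrix (Fin n) (Fin k) ℝ | 2 * k * L < ∑ j, inner ℝ v (colVec Z j) ^ 2} ⊆
      ⋃ j : Fin k, ({Z | √(2 * L) ≤ inner ℝ v (colVec Z j)} ∪
        {Z | √(2 * L) ≤ inner ℝ (-v) (colVec Z j)}) := by
    intro Z hZ
    by_contra hcon
    simp only [Set.mem_iUnion, Set.mem_union, Set.mem_ofPred_eq, not_exists, not_or, not_le,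
      inner_neg_left] at hcon
    have h2 : ∀ j ∈ Finset.univ, inner ℝ v (colVec Z j) ^ 2 ≤ 2 * L := by
      intro j _
      have h3 : |inner ℝ v (colVec Z j)| ≤ √(2 * L) :=
        abs_le.2 ⟨by linarith [(hcon j).2], (hcon j).1.le⟩
      rw [← sq_abs, ← Real.sq_sqrt (by positivity : 0 ≤ 2 * L)]
      gcongr
    have h4 := Finset.sum_le_sum h2
    rw [Finset.sum_const, Finset.card_univ, Fintype.card_fin, nsmul_eq_mul] at h4
    have h5 : 2 * k * L < ∑ j, inner ℝ v (colVec Z j) ^ 2 := hZ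
    linarith
  calc _ ≤ _ := measure_mono hsub
    _ ≤ ∑ j : Fin k, _ := measure_iUnion_fintype_le _ _
    _ ≤ ∑ j : Fin k, (ENNReal.ofReal (Real.exp (-L)) + ENNReal.ofReal (Real.exp (-L))) :=
        Finset.sum_le_sum fun j _ => (measure_union_le _ _).trans
          (add_le_add (htail j v hv) (htail j (-v) (by rwa [norm_neg])))
    _ = _ := by
        rw [Finset.sum_const, Finset.card_univ, Fintype.card_fin, nsmul_eq_mul,
          ← ENNReal.ofReal_add (Real.exp_pos _).le (Real.exp_pos _).le, ← ENNReal.ofReal_natCast,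
          ← ENNReal.ofReal_mul (Nat.cast_nonneg k)]
        congr 1
        ring

/-- Privacy of the range finder. Half of `δ` pays for the event that the sensitivity exceeds
`√(2 k L)`, where `L = log (4 k / δ)`; the other half covers the failure probability
`exp (-L) = δ / (4 k)` of the Gaussian mechanism. Orthonormalization is post-processing. -/
theorem isDifferentiallyPrivate_output {m n k : ℕ} {ε δ ρ : ℝ} (hε : 0 < ε) (hε1 : ε < 1)
    (hδ : 0 < δ) (hδ1 : δ < 1) (hρ : noiseScale k ε δ ≤ ρ) :
    IsDifferentiallyPrivate (seed m n k ρ) (output (m := m) (n := n) (k := k)) ε δ := by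
  intro A A' hAA' S hS
  rcases Nat.eq_zero_or_pos k with hk | hk
  · -- without columns there is only one possible output
    subst hk
    have h1 : ∀ θ : Matrix (Fin n) (Fin 0) ℝ × Matrix (Fin m) (Fin 0) ℝ,
        output A θ = output A' θ := fun θ => Subsingleton.elim _ _
    simp_rw [h1]
    have h2 : (1 : ENNReal) ≤ ENNReal.ofReal (Real.exp ε) := by
      rw [← ENNReal.ofReal_one]
      exact ENNReal.ofReal_le_ofReal (Real.one_le_exp hε.le)
    exact (le_mul_of_one_le_left zero_le h2).trans le_self_add
  obtain ⟨i, hi, hrow⟩ := hAA'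
  have hk1 : (1 : ℝ) ≤ k := by exact_mod_cast hk
  set L := Real.log (4 * k / δ) with hLdef
  have hL1 : 1 ≤ L := by
    rw [hLdef, Real.le_log_iff_exp_le (by positivity)]
    have h1 : (4 : ℝ) ≤ 4 * k / δ := by
      rw [le_div_iff₀ hδ]
      nlinarith
    have h2 := Real.exp_one_lt_d9
    linarith
  have hexpL : Real.exp (-L) = δ / (4 * k) := by
    rw [Real.exp_neg, hLdef, Real.exp_log (by positivity), inv_div]
  have hns : 0 < noiseScale k ε δ := by
    rw [noiseScale]
    have : 0 < Real.log (4 * k / δ) := by linarith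
    positivity
  have hρ0 : 0 < ρ := hns.trans_le hρ
  have hρ2 : 8 * k * L ^ 2 ≤ ρ ^ 2 * ε ^ 2 := by
    have h1 : noiseScale k ε δ ^ 2 ≤ ρ ^ 2 := pow_le_pow_left₀ hns.le hρ 2
    have h2 : noiseScale k ε δ ^ 2 * ε ^ 2 = 8 * k * L ^ 2 := by
      rw [noiseScale, ← hLdef, mul_pow, mul_pow, mul_pow, Real.sq_sqrt (by positivity)]
      field_simp
      ring
    rw [← h2]
    gcongr
  set v : EuclideanSpace ℝ (Fin n) := WithLp.toLp 2 ((A - A') i) with hv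
  set T := (orthonormalizeColumns : Matrix (Fin m) (Fin k) ℝ → _) ⁻¹' S with hTdef
  have hT : MeasurableSet T := measurable_orthonormalizeColumns hS
  set bad : Set (Matrix (Fin n) (Fin k) ℝ) :=
    {Z | 2 * k * L < ∑ j, inner ℝ v (colVec Z j) ^ 2} with hbad
  have hbadm : MeasurableSet bad := measurableSet_lt measurable_const
    (Finset.measurable_sum _ fun j _ => ((measurable_const.inner (measurable_colVec j)).pow_const 2))
  have hprod : ∀ B : Matrix (Fin m) (Fin n) ℝ, (seed m n k ρ) {θ | output B θ ∈ S} =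
      ∫⁻ Z, gaussianMatrix m k ρ {N | B * Z + N ∈ T} ∂(gaussianMatrix n k 1) := by
    intro B
    exact Measure.prod_apply (μ := gaussianMatrix n k 1) (ν := gaussianMatrix m k ρ)
      (measurable_sketch B hT)
  have hpt : ∀ Z : Matrix (Fin n) (Fin k) ℝ, gaussianMatrix m k ρ {N | A * Z + N ∈ T} ≤
      ENNReal.ofReal (Real.exp ε) * gaussianMatrix m k ρ {N | A' * Z + N ∈ T} +
        (ENNReal.ofReal (δ / 2) + bad.indicator 1 Z) := by
    intro Z
    by_cases hZ : Z ∈ bad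
    · rw [Set.indicator_of_mem hZ, Pi.one_apply]
      exact prob_le_one.trans (le_add_left le_add_self)
    · have hZ' : ∑ j, inner ℝ v (colVec Z j) ^ 2 ≤ 2 * k * L := not_lt.1 hZ
      have hrowZ : ∀ j, j ≠ i → (A * Z) j = (A' * Z) j := by
        intro j hj
        funext c
        have h1 : ((A - A') * Z) j c = 0 := by
          rw [Matrix.mul_apply]
          exact Finset.sum_eq_zero fun l _ => by rw [hrow j hj, Pi.zero_apply, zero_mul]
        rw [Matrix.sub_mul, Matrix.sub_apply] at h1
        linarith
      have hnorm : ‖rowVec (A * Z - A' * Z) i‖ ^ 2 = ∑ j, inner ℝ v (colVec Z j) ^ 2 := by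
        rw [← Matrix.sub_mul, EuclideanSpace.norm_sq_eq]
        refine Finset.sum_congr rfl fun j _ => ?_
        rw [Real.norm_eq_abs, sq_abs]
        congr 1
        simp [rowVec, hv, colVec, Matrix.mul_apply, PiLp.inner_apply, mul_comm]
      have h2 := gaussian_mechanism_matrix hrowZ hρ0 hε hε1 hL1 (by
        rw [hnorm]
        calc 4 * L * ∑ j, inner ℝ v (colVec Z j) ^ 2 ≤ 4 * L * (2 * k * L) := by gcongr
          _ = 8 * k * L ^ 2 := by ring
          _ ≤ _ := hρ2) hT
      refine h2.trans ?_
      gcongr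
      refine le_trans (ENNReal.ofReal_le_ofReal ?_) le_self_add
      rw [hexpL]
      exact div_le_div_of_nonneg_left hδ.le two_pos (by linarith)
  rw [hprod, hprod]
  refine (lintegral_mono hpt).trans ?_
  rw [lintegral_add_right _ (show Measurable fun Z : Matrix (Fin n) (Fin k) ℝ =>
      ENNReal.ofReal (δ / 2) + bad.indicator 1 Z from
        (measurable_one.indicator hbadm).const_add _),
    lintegral_const_mul' _ _ ENNReal.ofReal_ne_top, lintegral_add_left measurable_const,
    lintegral_const, measure_univ, mul_one, lintegral_indicator_one hbadm]
  gcongr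
  calc _ ≤ ENNReal.ofReal (δ / 2) + ENNReal.ofReal (2 * k * Real.exp (-L)) := by
        gcongr
        exact measure_sensitivity_le hi (by linarith)
    _ = ENNReal.ofReal (δ / 2) + ENNReal.ofReal (δ / 2) := by
        rw [hexpL]
        congr 2
        field_simp
        norm_num
    _ = ENNReal.ofReal δ := by
        rw [← ENNReal.ofReal_add (by positivity) (by positivity), add_halves]

end RangeFinder

theorem mainTheorem3 :
    -- privacy, at the calibrated noise scale and at every larger one
    (∀ (m n r p : ℕ), r + p ≤ min m n →
      ∀ ε ∈ Set.Ioo (0 : ℝ) 1, ∀ δ ∈ Set.Ioo (0 : ℝ) 1,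
      ∀ ρ : ℝ, RangeFinder.noiseScale (r + p) ε δ ≤ ρ →
        RangeFinder.IsDifferentiallyPrivate (RangeFinder.seed m n (r + p) ρ)
          (RangeFinder.output (m := m) (n := n) (k := r + p)) ε δ) ∧
    -- bound on the expected error, at every noise scale
    (∀ (m n r p : ℕ), 2 ≤ p → r + p ≤ min m n →
      ∀ ρ : ℝ, 0 ≤ ρ → ∀ A : Matrix (Fin m) (Fin n) ℝ,
        Integrable (fun θ => RangeFinder.error A (RangeFinder.output A θ))
          (RangeFinder.seed m n (r + p) ρ) ∧
        ∫ θ, RangeFinder.error A (RangeFinder.output A θ) ∂(RangeFinder.seed m n (r + p) ρ) ≤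
          √(1 + (r : ℝ) / ((p : ℝ) - 1)) *
            √(∑ j ∈ Finset.Ico r m, (RangeFinder.singularValue A j + ρ) ^ 2)) ∧
    -- bound that holds with probability 99/100, with a universal constant
    (∃ C : ℝ, 0 < C ∧
      ∀ (m n r p : ℕ), m ≤ n → r + 1 ≤ p → r + p ≤ min m n →
      ∀ ρ : ℝ, 0 ≤ ρ → ∀ A : Matrix (Fin m) (Fin n) ℝ,
        ENNReal.ofReal (99 / 100) ≤
          (RangeFinder.seed m n (r + p) ρ)
            {θ | RangeFinder.error A (RangeFinder.output A θ) ≤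
              C * (√(∑ j ∈ Finset.Ico r m, RangeFinder.singularValue A j ^ 2) + ρ * √m)}) := by
  refine ⟨fun m n r p _ ε hε δ hδ ρ hρ =>
      RangeFinder.isDifferentiallyPrivate_output hε.1 hε.2 hδ.1 hδ.2 hρ,
    fun m n r p hp hk ρ hρ A => ⟨(RangeFinder.memLp_error A ρ).integrable one_le_two,
      RangeFinder.integral_error_le hp le_rfl (by omega) A hρ⟩,
    200, by norm_num, fun m n r p _ hrp hk ρ hρ A => RangeFinder.measure_error_le hrp hk A hρ⟩
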